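/- **Proposition (Local Estimate).** Let $d\ge 1$, $\epsilon>0$ and $A>0$. There is a constant $c>0$, depending only on $d,\epsilon,A$, with the following property. Let $0<T^*<\infty$ and $\alpha\ge\frac12$, let $u_0\in L^2(\mathbb{R}^d)$, and let $u\in C([0,T^*);L^2(\mathbb{R}^d))\cap L^{2(d+2)/d}_{\mathrm{loc}}([0,T^*);L^{2(d+2)/d}(\mathbb{R}^d))$ be a (distributional) solution of the $L^2$-critical Schrödinger equation $$ i u_t+\Delta u=\pm|u|^{4/d}u,\qquad u(0)=u_0, $$ (either sign) with maximal forward existence interval $[0,T^*)$. This means that for every admissible pair $(q,r)$ (that is, $2\le q<\infty$, $2\le r\le\infty$, $\frac2q+\frac dr=\frac d2$, $(d,q,r)\neq(2,2,\infty)$) one has $\|u\|_{L^q_tL^r_x([0,t]\times\mathbb{R}^d)}<\infty$ for all $t<T^*$ and $\|u\|_{L^q_tL^r_x([0,T^*)\times\mathbb{R}^d)}=\infty$. Put $$\kappa(\epsilon)=2^{-(d+2)}\bigl(\epsilon\,\|u_0\|_{L^2}^{-2}/8\bigr)^{1/d},\qquad L(t)=\frac{A\,\kappa(\epsilon)}{(T^*-t)^{\alpha}},\qquad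 F(t)=\|u\|_{L^{2(d+2)/d}([0,t]\times\mathbb{R}^d)}^{2(d+2)/d},$$ and let $P_{L}$ be the Fourier restriction to $\{|\xi|\le L\}$, i.e. $\widehat{P_Lf}=\mathbf 1_{\{|\xi|\le L\}}\hat f$, where $\hat f(\xi)=\int e^{-2\pi i x\cdot\xi}f(x)\,dx$. Suppose that $$\limsup_{t\nearrow T^*}\ \sup_{J}\int_J|P_{L(t)}u(t,x)|^2\,dx\ \ge\ \epsilon,$$ where the supremum is over all (axis-parallel) cubes $J\subset\mathbb{R}^d$ of side length $l(J)<(T^*-t)^\alpha$. Then there is a strictly increasing sequence of times $t_n\in(0,T^*)$, $t_n\to T^*$, such that $F$ is differentiable at every $t_n$ and $$F'(t_n)\ \ge\ \frac{c}{(T^*-t_n)^{2\alpha}}\qquad\text{for all } n.$$ -/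

import Mathlib

open MeasureTheory Set Filter Topology FourierTransform
open scoped ENNReal ContDiff

noncomputable section

/-- Euclidean space `ℝ^d`. -/
abbrev Space (d : ℕ) : Type := EuclideanSpace ℝ (Fin d)

/-- The complex Lebesgue space `L²(ℝ^d)`. -/
abbrev L2 (d : ℕ) : Type := Lp ℂ 2 (volume : Measure (Space d))

/-- The mixed norm `‖u‖_{L^q_t L^r_x (I × ℝ^d)}`, with values in `[0, ∞]`. -/
def mixedNorm {d : ℕ} (q r : ℝ≥0∞) (u : ℝ → L2 d) (I : Set ℝ) : ℝ≥0∞ :=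
  eLpNorm (fun s : ℝ => eLpNorm (u s) r (volume : Measure (Space d))) q (volume.restrict I)

/-- The diagonal Strichartz exponent `2(d+2)/d`, as a real number. -/
def diagExp (d : ℕ) : ℝ := 2 * ((d : ℝ) + 2) / d

/-- Admissible (Strichartz) pairs: `2/q + d/r = d/2` with `2 ≤ q, r ≤ ∞`. As usual the pair
`(2, ∞)` in dimension two is left out, and so is the pair `(∞, 2)`. -/
structure Admissible (d : ℕ) (q r : ℝ≥0∞) : Prop where
  two_le_q : 2 ≤ q
  two_le_r : 2 ≤ r
  scaling : 2 / q + (d : ℝ≥0∞) / r = (d : ℝ≥0∞) / 2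
  q_ne_top : q ≠ ⊤
  not_forbidden : ¬ (d = 2 ∧ q = 2)

/-- The mass-critical nonlinearity `|z|^{4/d} z`. -/
def nonlinearity (d : ℕ) (z : ℂ) : ℂ := ((‖z‖ ^ (4 / (d : ℝ)) : ℝ) : ℂ) * z

/-- `u` is an `L²` solution on `[0, T)` of `i u_t + Δ u = σ |u|^{4/d} u`, `u(0) = u₀`:
`u` is in `C([0, T); L²)`, its diagonal Strichartz norm is finite on `[0, t]` for all `t < T`, and
the equation, integrated in time, holds in the sense of distributions on `ℝ^d`. -/
structure IsSolution {d : ℕ} (σ T : ℝ) (u₀ : L2 d) (u : ℝ → L2 d) : Prop where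
  continuousOn : ContinuousOn u (Ico 0 T)
  initial : u 0 = u₀
  locally_strichartz : ∀ t ∈ Ico 0 T,
    mixedNorm (ENNReal.ofReal (diagExp d)) (ENNReal.ofReal (diagExp d)) u (Icc 0 t) < ⊤
  weak_eq : ∀ φ : Space d → ℂ, ContDiff ℝ ∞ φ → HasCompactSupport φ → ∀ t ∈ Ico 0 T,
    Complex.I * ((∫ x, u t x * φ x) - ∫ x, u₀ x * φ x)
        + ∫ s in (0 : ℝ)..t, ∫ x, u s x * Laplacian.laplacian φ x
      = (σ : ℂ) * ∫ s in (0 : ℝ)..t, ∫ x, nonlinearity d (u s x) * φ x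

/-- `u` is a maximal (forward) solution with maximal existence interval `[0, T)`: every
Strichartz norm is finite on `[0, t]` for all `t < T` and infinite on `[0, T)`. -/
structure IsMaximalSolution {d : ℕ} (σ T : ℝ) (u₀ : L2 d) (u : ℝ → L2 d) : Prop
    extends IsSolution σ T u₀ u where
  finite_before : ∀ q r : ℝ≥0∞, Admissible d q r → ∀ t ∈ Ico 0 T, mixedNorm q r u (Icc 0 t) < ⊤
  blowup : ∀ q r : ℝ≥0∞, Admissible d q r → mixedNorm q r u (Ico 0 T) = ⊤

/-- `F(t) = ‖u‖^{2(d+2)/d}` in `L^{2(d+2)/d}([0,t] × ℝ^d)`. -/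
def strichartzF {d : ℕ} (u : ℝ → L2 d) (t : ℝ) : ℝ :=
  (mixedNorm (ENNReal.ofReal (diagExp d)) (ENNReal.ofReal (diagExp d)) u (Icc 0 t)).toReal
    ^ diagExp d

/-- The Fourier restriction operator `P_{|ξ| ≤ L}` on `L²(ℝ^d)`: the inverse Fourier transform of
`1_{|ξ| ≤ L} 𝓕 f`, with `𝓕 f (ξ) = ∫ e^{-2π i x·ξ} f(x) dx`. -/
def freqTrunc {d : ℕ} (L : ℝ) (f : L2 d) : L2 d :=
  let g : L2 d := 𝓕 f
  𝓕⁻ (MemLp.toLp ((Metric.closedBall (0 : Space d) L).indicator g)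
    ((Lp.memLp g).indicator Metric.isClosed_closedBall.measurableSet) : L2 d)

/-- The cube with lower corner `a` and side length `ℓ`. -/
def cube {d : ℕ} (a : Space d) (ℓ : ℝ) : Set (Space d) :=
  {x | ∀ i, x i ∈ Ico (a i) (a i + ℓ)}

/-- The supremum of `∫_J |f|²` over all cubes `J` of side length less than `R`. -/
def supCubeMass {d : ℕ} (f : L2 d) (R : ℝ) : ℝ≥0∞ :=
  ⨆ (a : Space d) (ℓ : ℝ) (_ : 0 < ℓ) (_ : ℓ < R), ∫⁻ x in cube a ℓ, ‖f x‖ₑ ^ 2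

/-- `κ(ε) = 2^{-(d+2)} (ε ‖u₀‖^{-2} / 8)^{1/d}`. -/
def kappa {d : ℕ} (u₀ : L2 d) (ε : ℝ) : ℝ :=
  ((2 : ℝ) ^ (d + 2))⁻¹ * (ε * (‖u₀‖ ^ 2)⁻¹ / 8) ^ (1 / (d : ℝ))

end

/-! ### The frequency cutoff as convolution with a kernel in L². -/

section FourierKernel

variable {d : ℕ}

/-! Write p = 2(d+2)/d. At a time t₀ where some cube of side less than R = (T - t₀)^α carries mass
above ε/2 of P_L u, with L = Aκ/R, the norm ‖u(t₀)‖_p must be large. The cutoff is convolution with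
L^d K(L·), where K is the inverse transform of the unit ball indicator; K is bounded and in L².
Split the convolution at distance s/L, with s so large that the squared L² tail of K beyond s is at
most A^{-d}. By Cauchy–Schwarz and ‖u(t₀)‖₂ ≤ ‖u₀‖₂ the far part contributes at most κ^d ‖u₀‖² ≤ ε/8
on the cube. The near part therefore has mass above ε/8, while Hölder bounds it pointwise by a
constant times R^{-d/p} ‖u(t₀)‖_p. Since d - 2d/p = 4/p, this gives ‖u(t₀)‖_p^p > c R^{-2}
(`exists_const_lt_eLpNorm_of_lt_supCubeMass`).

F is the time integral of ‖u(t)‖_p^p, so F' equals this density almost everywhere, but t₀ may lie in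
the exceptional null set. By Fatou the L^p norm is lower semicontinuous on L², and u is continuous
into L²; the strict bound thus persists on a neighbourhood of t₀, which has positive measure and
contains a point of differentiability (`IsSolution.exists_deriv_strichartzF_ge`).

The bound ‖u(t)‖ ≤ ‖u₀‖ is not part of the definition of a solution, and the longer half of the
proof derives mass conservation from the distributional equation (`IsSolution.norm_eq`). For a
smooth even kernel k, consider the regularised mass Re ∫ u (k ⋆ ū). On a short interval [s, t], test
the equation against k ⋆ β with the fixed function β equal to the conjugate of u(t) + u(s): by
symmetry the boundary terms give exactly the increment of the regularised mass. In the time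
integrals β is close to twice the conjugate of u(τ); with that replacement the Laplacian term is
real and drops out, and the error is a small factor times an integrable weight. Summing over fine
partitions leaves only 2σ ∫ Im ∫ N(u)(k ⋆ ū), where N is the nonlinearity. Letting k shrink to a
point mass, the integrand tends to Im ∫ |u|^p = 0 and is dominated by 2‖u(τ)‖_p^p. -/

theorem integral_fourierInv_mul_eq {f g : Space d → ℂ} (hf : Integrable f) (hg : Integrable g) :
    ∫ ξ, 𝓕⁻ f ξ * g ξ = ∫ x, f x * 𝓕⁻ g x := by
  have h := VectorFourier.integral_fourierIntegral_smul_eq_flip (L := -innerₗ (Space d))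
    (μ := volume) (ν := volume) Real.continuous_fourierChar
    (show Continuous fun p : Space d × Space d => -inner ℝ p.1 p.2 by fun_prop) hf hg
  have hflip : (-innerₗ (Space d)).flip = -innerₗ (Space d) := by
    ext x y; simp [real_inner_comm]
  rw [hflip] at h
  exact h

theorem continuous_fourierInv {g : Space d → ℂ} (hg : Integrable g) : Continuous (𝓕⁻ g) :=
  VectorFourier.fourierIntegral_continuous (L := -innerₗ (Space d)) (μ := volume)
    Real.continuous_fourierChar (show Continuous fun p : Space d × Space d => -inner ℝ p.1 p.2 by fun_prop) hg

/-- On L¹ ∩ L² the Plancherel transform and the integral transform agree: tested against a Schwartz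
function, both move onto that function, the first through tempered distributions and the second by
Fubini. -/
theorem fourierInv_toLp_ae_eq {g : Space d → ℂ} (h1 : Integrable g) (h2 : MemLp g 2) :
    (𝓕⁻ (h2.toLp g) : L2 d) =ᵐ[volume] 𝓕⁻ g := by
  refine ae_eq_of_integral_contDiff_smul_eq
    ((Lp.memLp _).locallyIntegrable one_le_two)
    (continuous_fourierInv h1).locallyIntegrable ?_
  intro φ hφ hφc
  have hψc : HasCompactSupport (fun x => (φ x : ℂ)) :=
    hφc.comp_left (g := fun r : ℝ => (r : ℂ)) Complex.ofReal_zero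
  have hψ : ContDiff ℝ ∞ (fun x => (φ x : ℂ)) := Complex.ofRealCLM.contDiff.comp hφ
  set ψ : SchwartzMap (Space d) ℂ := hψc.toSchwartzMap hψ with hψdef
  have hψx : ∀ x, ψ x = (φ x : ℂ) := fun x => rfl
  have key : (Lp.toTemperedDistribution (𝓕⁻ (h2.toLp g) : L2 d)) ψ
      = Lp.toTemperedDistribution (h2.toLp g) (𝓕⁻ ψ) := by
    rw [← Lp.fourierInv_toTemperedDistribution_eq, TemperedDistribution.fourierInv_apply]
  rw [Lp.toTemperedDistribution_apply, Lp.toTemperedDistribution_apply] at key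
  calc ∫ x, φ x • (𝓕⁻ (h2.toLp g) : L2 d) x
      = ∫ x, ψ x • (𝓕⁻ (h2.toLp g) : L2 d) x := by simp [hψx]
    _ = ∫ x, (𝓕⁻ ψ) x • (h2.toLp g) x := key
    _ = ∫ x, 𝓕⁻ (ψ : Space d → ℂ) x * g x := by
        refine integral_congr_ae ?_
        filter_upwards [h2.coeFn_toLp] with x hx
        rw [hx, SchwartzMap.fourierInv_coe, smul_eq_mul]
    _ = ∫ x, ψ x * 𝓕⁻ g x := integral_fourierInv_mul_eq ψ.integrable h1
    _ = ∫ x, φ x • 𝓕⁻ g x := by simp [hψx]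

/-- The convolution kernel of the Fourier restriction to the ball of radius `L`. -/
noncomputable def ballKernel (d : ℕ) (L : ℝ) : Space d → ℂ :=
  𝓕⁻ ((Metric.closedBall (0 : Space d) L).indicator fun _ => (1 : ℂ))

theorem integrable_indicator_closedBall {L : ℝ} {h : Space d → ℂ} (hc : Continuous h) :
    Integrable ((Metric.closedBall (0 : Space d) L).indicator h) :=
  (integrable_indicator_iff Metric.isClosed_closedBall.measurableSet).2
    (hc.continuousOn.integrableOn_compact (isCompact_closedBall _ _))

theorem memLp_indicator_closedBall {L : ℝ} {h : Space d → ℂ} (hc : Continuous h) :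
    MemLp ((Metric.closedBall (0 : Space d) L).indicator h) 2 := by
  rw [memLp_indicator_iff_restrict Metric.isClosed_closedBall.measurableSet]
  have : IsFiniteMeasure (volume.restrict (Metric.closedBall (0 : Space d) L)) :=
    isFiniteMeasure_restrict.2 (isCompact_closedBall _ _).measure_lt_top.ne
  obtain ⟨C, hC⟩ := (isCompact_closedBall (0 : Space d) L).exists_bound_of_continuousOn
    hc.continuousOn
  refine MemLp.of_bound hc.aestronglyMeasurable C ?_
  exact (ae_restrict_iff' Metric.isClosed_closedBall.measurableSet).2 (ae_of_all _ hC)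

theorem continuous_ballKernel (L : ℝ) : Continuous (ballKernel d L) :=
  continuous_fourierInv (integrable_indicator_closedBall continuous_const)

theorem memLp_ballKernel (L : ℝ) : MemLp (ballKernel d L) 2 := by
  refine (memLp_congr_ae (fourierInv_toLp_ae_eq
    (integrable_indicator_closedBall (L := L) continuous_const)
    (memLp_indicator_closedBall continuous_const))).1 ?_
  exact Lp.memLp _

theorem fourierInv_indicator_closedBall (L : ℝ) (g : Space d → ℂ) (x : Space d) :
    𝓕⁻ ((Metric.closedBall (0 : Space d) L).indicator g) x
      = ∫ ξ in Metric.closedBall (0 : Space d) L, Real.fourierChar (inner ℝ ξ x) • g ξ := by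
  rw [Real.fourierInv_eq, ← integral_indicator Metric.isClosed_closedBall.measurableSet]
  congr 1 with ξ
  by_cases h : ξ ∈ Metric.closedBall (0 : Space d) L
  · simp [h]
  · simp [h]

theorem ballKernel_eq (L : ℝ) (x : Space d) :
    ballKernel d L x
      = ∫ ξ in Metric.closedBall (0 : Space d) L, (Real.fourierChar (inner ℝ ξ x) : ℂ) := by
  rw [ballKernel, fourierInv_indicator_closedBall]
  exact integral_congr_ae (ae_of_all _ fun ξ => mul_one (Real.fourierChar (inner ℝ ξ x) : ℂ))

theorem norm_ballKernel_le (L : ℝ) (x : Space d) :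
    ‖ballKernel d L x‖ ≤ volume.real (Metric.closedBall (0 : Space d) L) := by
  rw [ballKernel_eq]
  refine (norm_setIntegral_le_of_norm_le_const (C := 1)
    (isCompact_closedBall _ _).measure_lt_top fun ξ _ => ?_).trans_eq (one_mul _)
  exact (Circle.norm_coe _).le

/-- Substitute Lξ for ξ. A tail estimate for the single kernel with L = 1 then serves every
frequency L. -/
theorem ballKernel_scale {L : ℝ} (hL : 0 < L) (x : Space d) :
    ballKernel d L x = ((L ^ d : ℝ) : ℂ) * ballKernel d 1 (L • x) := by
  rw [ballKernel_eq, ballKernel_eq, ← integral_indicator Metric.isClosed_closedBall.measurableSet,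
    ← integral_indicator Metric.isClosed_closedBall.measurableSet]
  have h := Measure.integral_comp_smul (volume : Measure (Space d))
    ((Metric.closedBall (0 : Space d) L).indicator
      fun ξ => (Real.fourierChar (inner ℝ ξ x) : ℂ)) L
  have h2 : (fun ξ => (Metric.closedBall (0 : Space d) L).indicator
      (fun ξ => (Real.fourierChar (inner ℝ ξ x) : ℂ)) (L • ξ))
      = (Metric.closedBall (0 : Space d) 1).indicator
        (fun ξ => (Real.fourierChar (inner ℝ ξ (L • x)) : ℂ)) := by
    ext ξ
    have : L • ξ ∈ Metric.closedBall (0 : Space d) L ↔ ξ ∈ Metric.closedBall (0 : Space d) 1 := by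
      simp only [mem_closedBall_zero_iff, norm_smul, Real.norm_eq_abs, abs_of_pos hL]
      exact mul_le_iff_le_one_right hL
    by_cases hξ : ξ ∈ Metric.closedBall (0 : Space d) 1
    · rw [indicator_of_mem hξ, indicator_of_mem (this.2 hξ), inner_smul_left, inner_smul_right]
      simp
    · rw [indicator_of_notMem hξ, indicator_of_notMem (fun h => hξ (this.1 h))]
  rw [h2] at h
  rw [h, finrank_euclideanSpace_fin]
  rw [abs_of_pos (by positivity), Complex.real_smul, ← mul_assoc, ← Complex.ofReal_mul,
    mul_inv_cancel₀ (by positivity), Complex.ofReal_one, one_mul]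

/-- Plancherel for f and the inverse transform of the modulated indicator e^{-2πi ξ·x} 1_{|ξ| ≤ L},
which is the conjugate of the kernel at x - y. Only membership of the kernel in L² is used, not
integrability. -/
theorem freqTrunc_ae_eq (L : ℝ) (f : L2 d) :
    ∀ᵐ x, freqTrunc L f x = ∫ y, ballKernel d L (x - y) * f y := by
  have hB := (Metric.isClosed_closedBall (x := (0 : Space d)) (ε := L)).measurableSet
  set g : L2 d := 𝓕 f with hg
  have hm : MemLp ((Metric.closedBall (0 : Space d) L).indicator g) 2 :=
    (Lp.memLp g).indicator hB
  have hi : Integrable ((Metric.closedBall (0 : Space d) L).indicator g) :=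
    (integrable_indicator_iff hB).2
      (((Lp.memLp g).locallyIntegrable one_le_two).integrableOn_isCompact
        (isCompact_closedBall _ _))
  filter_upwards [fourierInv_toLp_ae_eq hi hm] with x hx
  have hx' : freqTrunc L f x = 𝓕⁻ ((Metric.closedBall (0 : Space d) L).indicator g) x := hx
  rw [hx', fourierInv_indicator_closedBall]
  set e : Space d → ℂ := fun ξ => (Real.fourierChar (-inner ℝ ξ x) : ℂ) with he
  have hec : Continuous e := by fun_prop
  have hmem := memLp_indicator_closedBall (L := L) hec
  have hinv := fourierInv_toLp_ae_eq (integrable_indicator_closedBall (L := L) hec) hmem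
  have hP := Lp.inner_fourier_eq (𝓕⁻ (hmem.toLp _) : L2 d) f
  rw [FourierTransform.fourier_fourierInv_eq, ← hg, L2.inner_def, L2.inner_def] at hP
  calc ∫ ξ in Metric.closedBall (0 : Space d) L, Real.fourierChar (inner ℝ ξ x) • g ξ
      = ∫ ξ, inner ℂ ((hmem.toLp _) ξ) (g ξ) := by
        rw [← integral_indicator hB]
        refine integral_congr_ae ?_
        filter_upwards [hmem.coeFn_toLp] with ξ hξ
        rw [hξ]
        by_cases h : ξ ∈ Metric.closedBall (0 : Space d) L
        · rw [indicator_of_mem h, indicator_of_mem h, RCLike.inner_apply]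
          have h1 : (starRingEnd ℂ) (e ξ) = (Real.fourierChar (inner ℝ ξ x) : ℂ) := by
            simp only [he]
            rw [AddChar.map_neg_eq_inv, Circle.coe_inv_eq_conj, Complex.conj_conj]
          rw [h1]
          exact mul_comm (Real.fourierChar (inner ℝ ξ x) : ℂ) (g ξ)
        · rw [indicator_of_notMem h, indicator_of_notMem h, inner_zero_left]
    _ = ∫ y, inner ℂ ((𝓕⁻ (hmem.toLp _) : L2 d) y) (f y) := hP
    _ = ∫ y, ballKernel d L (x - y) * f y := by
        refine integral_congr_ae ?_
        filter_upwards [hinv] with y hy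
        rw [hy, RCLike.inner_apply, fourierInv_indicator_closedBall, ballKernel_eq,
          ← integral_conj, mul_comm]
        congr 1
        refine integral_congr_ae (ae_of_all _ fun ξ => ?_)
        have h1 : Real.fourierChar (inner ℝ ξ y) • e ξ
            = (Real.fourierChar (inner ℝ ξ y) : ℂ) * (Real.fourierChar (-inner ℝ ξ x) : ℂ) := rfl
        simp only [h1]
        rw [← Circle.coe_mul, ← AddChar.map_add_eq_mul,
          ← Circle.coe_inv_eq_conj, ← AddChar.map_neg_eq_inv, inner_sub_right]
        congr 2
        ring

theorem norm_freqTrunc_le (L : ℝ) (f : L2 d) : ‖freqTrunc L f‖ ≤ ‖f‖ := by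
  have hB := (Metric.isClosed_closedBall (x := (0 : Space d)) (ε := L)).measurableSet
  set g : L2 d := 𝓕 f with hg
  have hm : MemLp ((Metric.closedBall (0 : Space d) L).indicator g) 2 :=
    (Lp.memLp g).indicator hB
  have h1 : freqTrunc L f = 𝓕⁻ (hm.toLp _) := rfl
  rw [h1, ← Lp.norm_fourier_eq, FourierTransform.fourier_fourierInv_eq, ← Lp.norm_fourier_eq f]
  refine Lp.norm_le_norm_of_ae_le ?_
  filter_upwards [hm.coeFn_toLp] with x hx
  rw [hx]
  exact norm_indicator_le_norm_self _ _

end FourierKernel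

/-! ### Pointwise near/far bounds for the frequency cutoff. -/

section LocalEstimate

variable {d : ℕ}

theorem volume_cube (a : Space d) (ℓ : ℝ) : volume (cube a ℓ) = ENNReal.ofReal ℓ ^ d := by
  have h : cube a ℓ = (MeasurableEquiv.toLp 2 (Fin d → ℝ)).symm ⁻¹'
      (Set.univ.pi fun i => Ico (a i) (a i + ℓ)) := by
    ext x
    simp [cube]
  rw [h, (PiLp.volume_preserving_ofLp (Fin d)).measure_preimage_equiv, Real.volume_pi_Ico]
  simp

/-- The measure with density |k|² is finite and the complements of balls decrease to the empty set.
-/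
theorem exists_tail_le {k : Space d → ℂ} (hk : MemLp k 2) {τ : ℝ} (hτ : 0 < τ) :
    ∃ s : ℝ, 0 < s ∧ ∫⁻ z in (Metric.closedBall (0 : Space d) s)ᶜ, ‖k z‖ₑ ^ (2 : ℝ)
      ≤ ENNReal.ofReal τ := by
  set ν : Measure (Space d) := volume.withDensity fun z => ‖k z‖ₑ ^ (2 : ℝ) with hν
  have hfin : ν univ ≠ ⊤ := by
    rw [hν, withDensity_apply _ MeasurableSet.univ, Measure.restrict_univ]
    have := hk.eLpNorm_lt_top
    rw [eLpNorm_eq_lintegral_rpow_enorm_toReal (by norm_num) (by norm_num)] at this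
    simp only [ENNReal.toReal_ofNat] at this
    exact ((ENNReal.rpow_lt_top_iff_of_pos (by norm_num)).1 this).ne
  have hmeas : ∀ n : ℕ, MeasurableSet (Metric.closedBall (0 : Space d) (n : ℝ))ᶜ :=
    fun n => Metric.isClosed_closedBall.measurableSet.compl
  have hlim := tendsto_measure_iInter_atTop (μ := ν)
    (s := fun n : ℕ => (Metric.closedBall (0 : Space d) (n : ℝ))ᶜ)
    (fun n => (hmeas n).nullMeasurableSet)
    (fun m n hmn => compl_subset_compl.2 (Metric.closedBall_subset_closedBall (by exact_mod_cast hmn)))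
    ⟨0, ne_top_of_le_ne_top hfin (measure_mono (subset_univ _))⟩
  have hempty : ⋂ n : ℕ, (Metric.closedBall (0 : Space d) (n : ℝ))ᶜ = ∅ := by
    rw [← compl_iUnion, Metric.iUnion_closedBall_nat, compl_univ]
  rw [hempty, measure_empty] at hlim
  have hev := (hlim.eventually_lt_const (ENNReal.ofReal_pos.2 hτ)).and (eventually_gt_atTop 0)
  obtain ⟨n, hn, hn0⟩ := hev.exists
  refine ⟨n, by exact_mod_cast hn0, ?_⟩
  have := hn.le
  rwa [hν, Function.comp_apply, withDensity_apply _ (hmeas n)] at this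

/-- The squared amplitude contributes L^{2d} and the change of variables L^{-d}. -/
theorem lintegral_tail_ballKernel {L s : ℝ} (hL : 0 < L) :
    ∫⁻ z in (Metric.closedBall (0 : Space d) (s / L))ᶜ, ‖ballKernel d L z‖ₑ ^ (2 : ℝ)
      = ENNReal.ofReal (L ^ d) *
        ∫⁻ z in (Metric.closedBall (0 : Space d) s)ᶜ, ‖ballKernel d 1 z‖ₑ ^ (2 : ℝ) := by
  have hB : ∀ r : ℝ, MeasurableSet (Metric.closedBall (0 : Space d) r)ᶜ :=
    fun r => Metric.isClosed_closedBall.measurableSet.compl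
  rw [← lintegral_indicator (hB _), ← lintegral_indicator (hB _)]
  set F : Space d → ℝ≥0∞ := (Metric.closedBall (0 : Space d) s)ᶜ.indicator
    fun z => ‖ballKernel d 1 z‖ₑ ^ (2 : ℝ) with hF
  have hFm : Measurable F :=
    Measurable.indicator (by have := (continuous_ballKernel (d := d) 1).measurable; fun_prop) (hB _)
  have h1 : ∀ z, (Metric.closedBall (0 : Space d) (s / L))ᶜ.indicator
      (fun z => ‖ballKernel d L z‖ₑ ^ (2 : ℝ)) z
      = ENNReal.ofReal (L ^ d) ^ (2 : ℝ) * F (L • z) := by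
    intro z
    have : z ∈ (Metric.closedBall (0 : Space d) (s / L))ᶜ
        ↔ L • z ∈ (Metric.closedBall (0 : Space d) s)ᶜ := by
      simp only [mem_compl_iff, mem_closedBall_zero_iff, norm_smul, Real.norm_eq_abs, abs_of_pos hL,
        le_div_iff₀ hL, mul_comm]
    by_cases hz : z ∈ (Metric.closedBall (0 : Space d) (s / L))ᶜ
    · rw [indicator_of_mem hz, hF, indicator_of_mem (this.1 hz), ballKernel_scale hL, enorm_mul,
        ENNReal.mul_rpow_of_nonneg _ _ (by norm_num)]
      congr 2
      rw [← ofReal_norm, Complex.norm_real, Real.norm_of_nonneg (by positivity)]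
    · rw [indicator_of_notMem hz, hF, indicator_of_notMem (fun h => hz (this.2 h)), mul_zero]
  simp_rw [h1]
  rw [lintegral_const_mul _ (f := fun z => F (L • z)) (hFm.comp (measurable_const_smul L))]
  have h2 : ∫⁻ z, F (L • z) = ENNReal.ofReal ((L ^ d)⁻¹) * ∫⁻ z, F z := by
    have hmap := Measure.map_addHaar_smul (volume : Measure (Space d)) hL.ne'
    rw [← lintegral_map hFm (measurable_const_smul L), hmap, lintegral_smul_measure,
      finrank_euclideanSpace_fin, abs_of_pos (by positivity), smul_eq_mul]
  rw [h2, ← mul_assoc]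
  congr 1
  rw [ENNReal.ofReal_rpow_of_pos (by positivity), ← ENNReal.ofReal_mul (by positivity)]
  congr 1
  rw [Real.rpow_two]
  field_simp

theorem setLIntegral_enorm_closedBall_le (f : L2 d) {p : ℝ} (hp : 1 ≤ p) (x : Space d) (r : ℝ) :
    ∫⁻ y in Metric.closedBall x r, ‖f y‖ₑ
      ≤ eLpNorm f (ENNReal.ofReal p) volume
        * volume (Metric.closedBall x r) ^ (1 - 1 / p) := by
  have h := eLpNorm_le_eLpNorm_mul_rpow_measure_univ (p := 1) (q := ENNReal.ofReal p)
    (μ := volume.restrict (Metric.closedBall x r)) (f := f)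
    (by simpa using hp) (Lp.aestronglyMeasurable f).restrict
  rw [eLpNorm_one_eq_lintegral_enorm, Measure.restrict_apply_univ,
    ENNReal.toReal_ofReal (by linarith), ENNReal.toReal_one, div_one] at h
  refine h.trans ?_
  gcongr
  exact Measure.restrict_le_self

/-- Split the convolution at |x - y| = ρ. Inside, the kernel is at most the volume of the frequency
ball and Hölder controls the local L¹ norm of f; outside, apply Cauchy–Schwarz with the L² tail of
the kernel. By translation invariance the bound does not depend on x. -/
theorem enorm_freqTrunc_le (f : L2 d) {p : ℝ} (hp : 1 ≤ p) {L ρ : ℝ} :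
    ∀ᵐ x, ‖freqTrunc L f x‖ₑ
      ≤ volume (Metric.closedBall (0 : Space d) L)
          * (eLpNorm f (ENNReal.ofReal p) volume
            * volume (Metric.closedBall (0 : Space d) ρ) ^ (1 - 1 / p))
        + (∫⁻ z in (Metric.closedBall (0 : Space d) ρ)ᶜ, ‖ballKernel d L z‖ₑ ^ (2 : ℝ))
            ^ (1 / 2 : ℝ) * ‖f‖ₑ := by
  filter_upwards [freqTrunc_ae_eq L f] with x hx
  rw [hx]
  have hBx : MeasurableSet (Metric.closedBall x ρ) := Metric.isClosed_closedBall.measurableSet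
  have hkm : Measurable (ballKernel d L) := (continuous_ballKernel L).measurable
  refine (enorm_integral_le_lintegral_enorm _).trans ?_
  rw [← lintegral_add_compl _ hBx]
  refine add_le_add ?_ ?_
  · calc ∫⁻ y in Metric.closedBall x ρ, ‖ballKernel d L (x - y) * f y‖ₑ
        ≤ ∫⁻ y in Metric.closedBall x ρ,
            volume (Metric.closedBall (0 : Space d) L) * ‖f y‖ₑ := by
          refine lintegral_mono fun y => ?_
          rw [enorm_mul]
          gcongr
          rw [← ofReal_norm, ← ENNReal.ofReal_toReal
            (isCompact_closedBall (0 : Space d) L).measure_lt_top.ne]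
          exact ENNReal.ofReal_le_ofReal (norm_ballKernel_le L _)
      _ = volume (Metric.closedBall (0 : Space d) L) * ∫⁻ y in Metric.closedBall x ρ, ‖f y‖ₑ :=
          lintegral_const_mul' _ _ (isCompact_closedBall _ _).measure_lt_top.ne
      _ ≤ _ := by
          gcongr
          refine (setLIntegral_enorm_closedBall_le f hp x ρ).trans_eq ?_
          rw [Measure.addHaar_closedBall_center]
  · have hH := ENNReal.lintegral_mul_le_Lp_mul_Lq
      (volume.restrict (Metric.closedBall x ρ)ᶜ) Real.HolderConjugate.two_two
      (f := fun y => ‖ballKernel d L (x - y)‖ₑ) (g := fun y => ‖f y‖ₑ)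
      (by fun_prop) (Lp.aestronglyMeasurable f).enorm.restrict
    simp only [enorm_mul]
    refine hH.trans (mul_le_mul' (ENNReal.rpow_le_rpow ?_ (by norm_num)) ?_)
    · have := lintegral_sub_left_eq_self (μ := (volume : Measure (Space d)))
        ((Metric.closedBall (0 : Space d) ρ)ᶜ.indicator
          fun z => ‖ballKernel d L z‖ₑ ^ (2 : ℝ)) x
      rw [lintegral_indicator Metric.isClosed_closedBall.measurableSet.compl] at this
      rw [← this, ← lintegral_indicator hBx.compl]
      refine lintegral_mono fun y => ?_
      by_cases hy : y ∈ (Metric.closedBall x ρ)ᶜ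
      · rw [indicator_of_mem hy, indicator_of_mem]
        simpa [dist_eq_norm, norm_sub_rev] using hy
      · rw [indicator_of_notMem hy]
        exact zero_le
    · rw [Lp.enorm_def, eLpNorm_eq_lintegral_rpow_enorm_toReal (by norm_num) (by norm_num)]
      simp only [ENNReal.toReal_ofNat]
      gcongr
      exact Measure.restrict_le_self

end LocalEstimate

/-! ### Concentration on a small cube forces a large diagonal norm. -/

section LocalLowerBound

variable {d : ℕ}

theorem diagExp_eq (hd : 0 < d) : diagExp d = 2 + 4 / d := by
  have : (d : ℝ) ≠ 0 := by positivity
  rw [diagExp]; field_simp; ring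

theorem two_le_diagExp (hd : 0 < d) : 2 ≤ diagExp d := by
  rw [diagExp_eq hd]
  have : (0 : ℝ) ≤ 4 / d := by positivity
  linarith

theorem volume_closedBall_zero {r : ℝ} (hr : 0 ≤ r) :
    volume (Metric.closedBall (0 : Space d) r)
      = ENNReal.ofReal (volume.real (Metric.closedBall (0 : Space d) 1) * r ^ d) := by
  rw [Measure.addHaar_closedBall' _ _ hr, finrank_euclideanSpace_fin, mul_comm,
    ENNReal.ofReal_mul (by positivity)]
  congr 1
  exact (ENNReal.ofReal_toReal (isCompact_closedBall _ _).measure_lt_top.ne).symm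

theorem volume_real_closedBall_pos :
    0 < volume.real (Metric.closedBall (0 : Space d) 1) :=
  ENNReal.toReal_pos (Metric.measure_closedBall_pos _ _ one_pos).ne'
    (isCompact_closedBall _ _).measure_lt_top.ne

/-- The splitting radius s/L makes the tail condition scale to one on the unit kernel, so s is
independent of L. -/
theorem norm_freqTrunc_le_near_add_far {p s τ L m M : ℝ} (hp : 1 ≤ p) (hs : 0 < s) (hL : 0 < L)
    (hm : 0 ≤ m) (hτ : 0 ≤ τ)
    (htail : ∫⁻ z in (Metric.closedBall (0 : Space d) s)ᶜ, ‖ballKernel d 1 z‖ₑ ^ (2 : ℝ)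
      ≤ ENNReal.ofReal τ)
    {f : L2 d} (hfp : eLpNorm f (ENNReal.ofReal p) volume ≤ ENNReal.ofReal m) (hfM : ‖f‖ ≤ M) :
    ∀ᵐ x, ‖freqTrunc L f x‖ₑ ≤ ENNReal.ofReal
      (volume.real (Metric.closedBall (0 : Space d) 1) * L ^ d
        * (m * (volume.real (Metric.closedBall (0 : Space d) 1) * (s / L) ^ d) ^ (1 - 1 / p))
        + (L ^ d * τ) ^ (1 / 2 : ℝ) * M) := by
  have hM : 0 ≤ M := (norm_nonneg f).trans hfM
  have hV := volume_real_closedBall_pos (d := d)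
  have hp' : 0 ≤ 1 - 1 / p := by
    rw [sub_nonneg, div_le_one (by linarith)]; exact hp
  filter_upwards [enorm_freqTrunc_le f hp (L := L) (ρ := s / L)] with x hx
  refine hx.trans ?_
  rw [ENNReal.ofReal_add (by positivity) (by positivity), ENNReal.ofReal_mul (by positivity),
    ENNReal.ofReal_mul hm, ENNReal.ofReal_mul (p := (L ^ d * τ) ^ (1 / 2 : ℝ)) (by positivity),
    ← ENNReal.ofReal_rpow_of_nonneg (by positivity) hp',
    ← ENNReal.ofReal_rpow_of_nonneg (p := 1 / 2) (by positivity) (by norm_num),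
    volume_closedBall_zero hL.le, volume_closedBall_zero (r := s / L) (by positivity)]
  refine add_le_add (by gcongr) (mul_le_mul' (ENNReal.rpow_le_rpow ?_ (by norm_num)) ?_)
  · rw [lintegral_tail_ballKernel hL, ENNReal.ofReal_mul (by positivity)]
    gcongr
  · rw [← ofReal_norm]
    exact ENNReal.ofReal_le_ofReal hfM

theorem lintegral_enorm_sq_eq (f : L2 d) : ∫⁻ x, ‖f x‖ₑ ^ 2 = ENNReal.ofReal (‖f‖ ^ 2) := by
  have h : ‖f‖ₑ = eLpNorm f 2 volume := Lp.enorm_def f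
  rw [eLpNorm_eq_lintegral_rpow_enorm_toReal (by norm_num) (by norm_num)] at h
  rw [ENNReal.ofReal_pow (norm_nonneg f), ofReal_norm, h, ← ENNReal.rpow_natCast,
    ← ENNReal.rpow_mul]
  simp

theorem kappa_pow (hd : 0 < d) (u₀ : L2 d) {ε : ℝ} (hε : 0 < ε) :
    kappa u₀ ε ^ d = (((2 : ℝ) ^ (d + 2))⁻¹) ^ d * (ε * (‖u₀‖ ^ 2)⁻¹ / 8) := by
  rw [kappa, mul_pow, ← Real.rpow_natCast ((_ : ℝ) ^ (1 / (d : ℝ))), ← Real.rpow_mul (by positivity),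
    one_div_mul_cancel (by positivity), Real.rpow_one]

theorem mul_rpow_div_pow_eq {V s L m p : ℝ} (d : ℕ) (hV : 0 < V) (hs : 0 < s) (hL : 0 < L) :
    V * L ^ d * (m * (V * (s / L) ^ d) ^ (1 - 1 / p))
      = V * (V * s ^ d) ^ (1 - 1 / p) * L ^ ((d : ℝ) / p) * m := by
  have h2 : (L ^ d : ℝ) = L ^ ((d : ℝ) / p) * (L ^ d) ^ (1 - 1 / p) := by
    rw [← Real.rpow_natCast, ← Real.rpow_mul hL.le, ← Real.rpow_add hL]
    congr 1; ring
  have h3 : (0 : ℝ) < (L ^ d) ^ (1 - 1 / p) := by positivity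
  have h4 : (V * (s / L) ^ d) ^ (1 - 1 / p)
      = (V * s ^ d) ^ (1 - 1 / p) / (L ^ d) ^ (1 - 1 / p) := by
    rw [← Real.div_rpow (by positivity) (by positivity), div_pow, mul_div_assoc']
  rw [h4, ← mul_div_assoc, ← mul_div_assoc, div_eq_iff h3.ne']
  nth_rewrite 1 [h2]
  ring

theorem inv_rpow_sq_mul_pow_eq (hd : 0 < d) {R : ℝ} (hR : 0 < R) :
    ((R ^ ((d : ℝ) / diagExp d))⁻¹) ^ 2 * R ^ d = (R ^ (2 / diagExp d)) ^ 2 := by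
  have hdR : (0 : ℝ) < d := by exact_mod_cast hd
  rw [← Real.rpow_neg hR.le, ← Real.rpow_natCast (R ^ (_ : ℝ)), ← Real.rpow_mul hR.le,
    ← Real.rpow_natCast R, ← Real.rpow_add hR, ← Real.rpow_natCast (R ^ (_ : ℝ)),
    ← Real.rpow_mul hR.le]
  congr 1
  rw [diagExp]
  push_cast
  field_simp
  ring

/-- The estimate at a fixed time, with no equation involved. The choice of κ makes the far part
negligible, and the near part is then bounded below. -/
theorem exists_const_lt_eLpNorm_of_lt_supCubeMass (hd : 0 < d) {ε A : ℝ} (hε : 0 < ε)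
    (hA : 0 < A) :
    ∃ c : ℝ, 0 < c ∧ ∀ (f u₀ : L2 d) (R : ℝ), 0 < R → ‖f‖ ≤ ‖u₀‖ →
      ENNReal.ofReal (ε / 2) < supCubeMass (freqTrunc (A * kappa u₀ ε / R) f) R →
      ENNReal.ofReal (c / R ^ 2)
        < eLpNorm f (ENNReal.ofReal (diagExp d)) volume ^ diagExp d := by
  set p := diagExp d with hpdef
  have hp2 : 2 ≤ p := two_le_diagExp hd
  have hdR : (0 : ℝ) < d := by exact_mod_cast hd
  -- With tail A^{-d} the far contribution on the cube is L^d A^{-d} ‖u₀‖² R^d = κ^d ‖u₀‖²; the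
  -- powers of A and R cancel.
  obtain ⟨s, hs, htail⟩ := exists_tail_le (memLp_ballKernel (d := d) 1)
    (τ := (A ^ d)⁻¹) (by positivity)
  set V := volume.real (Metric.closedBall (0 : Space d) 1) with hVdef
  have hV : 0 < V := volume_real_closedBall_pos
  set C : ℝ := V * (V * s ^ d) ^ (1 - 1 / p) * A ^ (d / p) with hC
  have hCpos : 0 < C := by positivity
  refine ⟨(ε / (8 * C ^ 2)) ^ (p / 2), by positivity, ?_⟩
  intro f u₀ R hR hfu hsup
  by_cases htop : eLpNorm f (ENNReal.ofReal p) volume = ⊤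
  · rw [htop, ENNReal.top_rpow_of_pos (by linarith)]
    exact ENNReal.ofReal_lt_top
  set m := (eLpNorm f (ENNReal.ofReal p) volume).toReal with hm
  have hm0 : 0 ≤ m := ENNReal.toReal_nonneg
  have hmf : eLpNorm f (ENNReal.ofReal p) volume = ENNReal.ofReal m :=
    (ENNReal.ofReal_toReal htop).symm
  set κ := kappa u₀ ε with hκ
  set L := A * κ / R with hL
  obtain ⟨a, ha⟩ := lt_iSup_iff.1 hsup
  obtain ⟨ℓ, hℓ⟩ := lt_iSup_iff.1 ha
  obtain ⟨hℓ0, hℓ⟩ := lt_iSup_iff.1 hℓ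
  obtain ⟨hℓR, hℓ⟩ := lt_iSup_iff.1 hℓ
  -- The cutoff contracts L², so concentration itself forces u₀ to be nonzero; this gives κ > 0 and,
  -- below, κ ≤ 1.
  have hmass : ε / 2 < ‖u₀‖ ^ 2 := by
    have h1 : ENNReal.ofReal (ε / 2) < ENNReal.ofReal (‖freqTrunc L f‖ ^ 2) := by
      rw [← lintegral_enorm_sq_eq]
      exact hℓ.trans_le (setLIntegral_le_lintegral _ _)
    have h2 := (ENNReal.ofReal_lt_ofReal_iff_of_nonneg (by positivity)).1 h1
    refine h2.trans_le ?_
    gcongr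
    exact (norm_freqTrunc_le L f).trans hfu
  have hu0 : 0 < ‖u₀‖ ^ 2 := lt_trans (by positivity) hmass
  have hκpos : 0 < κ := by rw [hκ, kappa]; positivity
  have h2d : (((2 : ℝ) ^ (d + 2))⁻¹) ^ d ≤ 1 :=
    pow_le_one₀ (by positivity) (inv_le_one_of_one_le₀ (one_le_pow₀ (by norm_num)))
  have hκM : κ ^ d * ‖u₀‖ ^ 2 ≤ ε / 8 := by
    rw [hκ, kappa_pow hd u₀ hε]
    calc _ = (((2 : ℝ) ^ (d + 2))⁻¹) ^ d * (ε / 8) := by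
          linear_combination ((((2 : ℝ) ^ (d + 2))⁻¹) ^ d * (ε / 8)) * inv_mul_cancel₀ hu0.ne'
      _ ≤ 1 * (ε / 8) := by gcongr
      _ = ε / 8 := one_mul _
  -- Needed to replace L by A/R in the near part, so that the constant C is independent of u₀.
  have hκ1 : κ ≤ 1 := by
    refine (pow_le_one_iff_of_nonneg hκpos.le hd.ne').1 ?_
    have : κ ^ d * (ε / 2) ≤ ε / 8 := le_trans (by gcongr) hκM
    by_contra! h
    nlinarith
  have hLpos : 0 < L := by positivity
  have hpt := norm_freqTrunc_le_near_add_far (by linarith : 1 ≤ p) hs hLpos hm0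
    (by positivity) htail hmf.le hfu
  set N₁ := V * L ^ d * (m * (V * (s / L) ^ d) ^ (1 - 1 / p)) with hN₁
  set N₂ := (L ^ d * (A ^ d)⁻¹) ^ (1 / 2 : ℝ) * ‖u₀‖ with hN₂
  have hN₁0 : 0 ≤ N₁ := by positivity
  have hN₂0 : 0 ≤ N₂ := by positivity
  have hint : ε / 2 < (N₁ + N₂) ^ 2 * R ^ d := by
    have h1 : ∫⁻ x in cube a ℓ, ‖freqTrunc L f x‖ₑ ^ 2
        ≤ ENNReal.ofReal ((N₁ + N₂) ^ 2 * R ^ d) := by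
      calc ∫⁻ x in cube a ℓ, ‖freqTrunc L f x‖ₑ ^ 2
          ≤ ∫⁻ x in cube a ℓ, ENNReal.ofReal (N₁ + N₂) ^ 2 := by
            refine lintegral_mono_ae (ae_restrict_of_ae ?_)
            filter_upwards [hpt] with x hx
            gcongr
        _ = ENNReal.ofReal (N₁ + N₂) ^ 2 * ENNReal.ofReal ℓ ^ d := by
            rw [setLIntegral_const, volume_cube]
        _ ≤ ENNReal.ofReal (N₁ + N₂) ^ 2 * ENNReal.ofReal R ^ d := by gcongr
        _ = _ := by
            rw [ENNReal.ofReal_mul (by positivity), ENNReal.ofReal_pow (by positivity),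
              ENNReal.ofReal_pow hR.le]
    exact (ENNReal.ofReal_lt_ofReal_iff_of_nonneg (by positivity)).1 (hℓ.trans_le h1)
  have hfar : N₂ ^ 2 * R ^ d ≤ ε / 8 := by
    have h1 : N₂ ^ 2 = L ^ d * (A ^ d)⁻¹ * ‖u₀‖ ^ 2 := by
      rw [hN₂, mul_pow, ← Real.rpow_natCast ((_ : ℝ) ^ (1 / 2 : ℝ)), ← Real.rpow_mul (by positivity)]
      norm_num
    have h2 : N₂ ^ 2 * R ^ d = κ ^ d * ‖u₀‖ ^ 2 := by
      rw [h1, hL, div_pow, mul_pow]; field_simp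
    rw [h2]; exact hκM
  have hnear : N₁ ≤ C * (R ^ ((d : ℝ) / p))⁻¹ * m := by
    have h1 : N₁ = V * (V * s ^ d) ^ (1 - 1 / p) * L ^ ((d : ℝ) / p) * m :=
      mul_rpow_div_pow_eq d hV hs hLpos
    have h4 : L ^ ((d : ℝ) / p) ≤ A ^ ((d : ℝ) / p) * (R ^ ((d : ℝ) / p))⁻¹ := by
      rw [← Real.inv_rpow hR.le, ← Real.mul_rpow hA.le (by positivity), hL, ← div_eq_mul_inv]
      refine Real.rpow_le_rpow (by positivity) ?_ (by positivity)
      gcongr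
      exact mul_le_of_le_one_right hA.le hκ1
    rw [h1, hC]
    calc _ ≤ V * (V * s ^ d) ^ (1 - 1 / p) * (A ^ ((d : ℝ) / p) * (R ^ ((d : ℝ) / p))⁻¹) * m := by
          gcongr
      _ = _ := by ring
  -- From ε/2 < 2(N₁² + N₂²)R^d and N₂² R^d ≤ ε/8.
  have hN1sq : ε / 8 < N₁ ^ 2 * R ^ d := by
    have : (N₁ + N₂) ^ 2 ≤ 2 * N₁ ^ 2 + 2 * N₂ ^ 2 := by nlinarith [sq_nonneg (N₁ - N₂)]
    have h5 : (N₁ + N₂) ^ 2 * R ^ d ≤ (2 * N₁ ^ 2 + 2 * N₂ ^ 2) * R ^ d := by gcongr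
    linarith
  have hkey : ε / (8 * C ^ 2) < (m * R ^ (2 / p)) ^ 2 := by
    rw [div_lt_iff₀ (by positivity)]
    have h6 : N₁ ^ 2 * R ^ d ≤ (C * (R ^ ((d : ℝ) / p))⁻¹ * m) ^ 2 * R ^ d := by gcongr
    have h7 : ((R ^ ((d : ℝ) / p))⁻¹) ^ 2 * R ^ d = (R ^ (2 / p)) ^ 2 :=
      inv_rpow_sq_mul_pow_eq hd hR
    have h8 : (C * (R ^ ((d : ℝ) / p))⁻¹ * m) ^ 2 * R ^ d
        = (m * R ^ (2 / p)) ^ 2 * C ^ 2 := by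
      calc _ = C ^ 2 * m ^ 2 * (((R ^ ((d : ℝ) / p))⁻¹) ^ 2 * R ^ d) := by ring
        _ = _ := by rw [h7]; ring
    linarith
  have hfinal : (ε / (8 * C ^ 2)) ^ (p / 2) < m ^ p * R ^ 2 := by
    have h9 := Real.rpow_lt_rpow (by positivity) hkey (by linarith : 0 < p / 2)
    refine h9.trans_eq ?_
    rw [← Real.rpow_natCast, ← Real.rpow_mul (by positivity), Nat.cast_ofNat,
      mul_div_cancel₀ _ (two_ne_zero), Real.mul_rpow hm0 (by positivity), ← Real.rpow_mul hR.le,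
      div_mul_cancel₀ _ (by linarith : p ≠ 0), Real.rpow_two]
  rw [hmf, ENNReal.ofReal_rpow_of_nonneg hm0 (by linarith)]
  refine (ENNReal.ofReal_lt_ofReal_iff_of_nonneg (by positivity)).2 ?_
  rwa [div_lt_iff₀ (by positivity)]

end LocalLowerBound

/-! ### The derivative of the Strichartz functional and the choice of times. -/

section StrichartzDerivative

variable {d : ℕ}

theorem exists_subseq_ae_tendsto {f : ℕ → L2 d} {g : L2 d} (h : Tendsto f atTop (𝓝 g)) :
    ∃ φ : ℕ → ℕ, StrictMono φ ∧ ∀ᵐ x, Tendsto (fun n => f (φ n) x) atTop (𝓝 (g x)) :=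
  (tendstoInMeasure_of_tendsto_Lp h).exists_seq_tendsto_ae

/-- Fatou along an almost everywhere convergent subsequence shows that sublevel sets are
sequentially closed in L². -/
theorem lowerSemicontinuous_eLpNorm (q : ℝ≥0∞) :
    LowerSemicontinuous fun f : L2 d => eLpNorm f q volume := by
  rw [lowerSemicontinuous_iff_isClosed_preimage]
  intro a
  refine IsSeqClosed.isClosed fun f g hf hfg => ?_
  obtain ⟨φ, -, hφ⟩ := exists_subseq_ae_tendsto hfg
  refine (Lp.eLpNorm_lim_le_liminf_eLpNorm (fun n => Lp.aestronglyMeasurable (f (φ n))) g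
    hφ).trans ?_
  refine (liminf_le_liminf (Eventually.of_forall fun n => hf (φ n))).trans ?_
  simp

/-- Freezing u outside [0, t] makes it continuous on the whole line without changing it on [0, t];
measurability statements there follow from global ones. -/
theorem continuous_comp_clamp {E : Type*} [TopologicalSpace E] {u : ℝ → E} {T t : ℝ}
    (hu : ContinuousOn u (Ico 0 T)) (h0 : 0 ≤ t) (ht : t < T) :
    Continuous fun s => u (max 0 (min s t)) :=
  hu.comp_continuous (by fun_prop) fun s =>
    ⟨le_max_left _ _, max_lt (h0.trans_lt ht) ((min_le_right _ _).trans_lt ht)⟩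

theorem clamp_eq {s t : ℝ} (hs : s ∈ Icc 0 t) : max 0 (min s t) = s := by
  rw [min_eq_left hs.2, max_eq_right hs.1]

theorem measurable_eLpNorm_rpow {v : ℝ → L2 d} (hv : Continuous v) (q : ℝ≥0∞) (p : ℝ) :
    Measurable fun s => eLpNorm (v s) q volume ^ p :=
  (((lowerSemicontinuous_eLpNorm q).comp hv).measurable).pow_const p

/-- The space integral `‖u(s)‖_p^p` at the diagonal exponent. -/
noncomputable def diagDensity (u : ℝ → L2 d) (s : ℝ) : ℝ≥0∞ :=
  eLpNorm (u s) (ENNReal.ofReal (diagExp d)) volume ^ diagExp d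

theorem mixedNorm_diag_rpow (hd : 0 < d) (u : ℝ → L2 d) (I : Set ℝ) :
    mixedNorm (ENNReal.ofReal (diagExp d)) (ENNReal.ofReal (diagExp d)) u I ^ diagExp d
      = ∫⁻ s in I, diagDensity u s := by
  have hp : 0 < diagExp d := by linarith [two_le_diagExp hd]
  rw [mixedNorm, eLpNorm_eq_lintegral_rpow_enorm_toReal (by simpa using hp) ENNReal.ofReal_ne_top,
    ENNReal.toReal_ofReal hp.le, ← ENNReal.rpow_mul, one_div_mul_cancel hp.ne', ENNReal.rpow_one]
  rfl

theorem aemeasurable_diagDensity {u : ℝ → L2 d} {T t : ℝ}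
    (hu : ContinuousOn u (Ico 0 T)) (ht : t ∈ Ico 0 T) :
    AEMeasurable (diagDensity u) (volume.restrict (Icc 0 t)) := by
  refine ⟨_, measurable_eLpNorm_rpow (continuous_comp_clamp hu ht.1 ht.2)
    (ENNReal.ofReal (diagExp d)) (diagExp d), ?_⟩
  filter_upwards [ae_restrict_mem measurableSet_Icc] with s hs
  rw [diagDensity, clamp_eq hs]

theorem IsSolution.lintegral_diagDensity_lt_top (hd : 0 < d) {σ T : ℝ} {u₀ : L2 d}
    {u : ℝ → L2 d} (hu : IsSolution σ T u₀ u) {t : ℝ} (ht : t ∈ Ico 0 T) :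
    ∫⁻ s in Icc 0 t, diagDensity u s < ⊤ := by
  rw [← mixedNorm_diag_rpow hd]
  exact ENNReal.rpow_lt_top_of_nonneg (by linarith [two_le_diagExp hd])
    (hu.locally_strichartz t ht).ne

theorem IsSolution.ae_diagDensity_lt_top (hd : 0 < d) {σ T : ℝ} {u₀ : L2 d}
    {u : ℝ → L2 d} (hu : IsSolution σ T u₀ u) {t : ℝ} (ht : t ∈ Ico 0 T) :
    ∀ᵐ s ∂(volume.restrict (Icc 0 t)), diagDensity u s < ⊤ :=
  ae_lt_top' (aemeasurable_diagDensity hu.continuousOn ht)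
    (hu.lintegral_diagDensity_lt_top hd ht).ne

theorem IsSolution.intervalIntegrable_diagDensity (hd : 0 < d) {σ T : ℝ} {u₀ : L2 d}
    {u : ℝ → L2 d} (hu : IsSolution σ T u₀ u) {t : ℝ} (ht : t ∈ Ico 0 T) :
    IntervalIntegrable (fun s => (diagDensity u s).toReal) volume 0 t := by
  rw [intervalIntegrable_iff_integrableOn_Icc_of_le ht.1]
  exact integrable_toReal_of_lintegral_ne_top (aemeasurable_diagDensity hu.continuousOn ht)
    (hu.lintegral_diagDensity_lt_top hd ht).ne

theorem IsSolution.strichartzF_eq_integral (hd : 0 < d) {σ T : ℝ} {u₀ : L2 d}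
    {u : ℝ → L2 d} (hu : IsSolution σ T u₀ u) {t : ℝ} (ht : t ∈ Ico 0 T) :
    strichartzF u t = ∫ s in (0 : ℝ)..t, (diagDensity u s).toReal := by
  rw [strichartzF, ENNReal.toReal_rpow, mixedNorm_diag_rpow hd,
    intervalIntegral.integral_of_le ht.1, ← integral_Icc_eq_integral_Ioc,
    integral_toReal (aemeasurable_diagDensity hu.continuousOn ht) (hu.ae_diagDensity_lt_top hd ht)]

theorem IsSolution.ae_hasDerivAt_strichartzF (hd : 0 < d) {σ T : ℝ} {u₀ : L2 d}
    {u : ℝ → L2 d} (hu : IsSolution σ T u₀ u) {t : ℝ} (ht : t ∈ Ico 0 T) :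
    ∀ᵐ s, s ∈ Ioo 0 t → HasDerivAt (strichartzF u) (diagDensity u s).toReal s
      ∧ diagDensity u s < ⊤ := by
  filter_upwards [(hu.intervalIntegrable_diagDensity hd ht).ae_hasDerivAt_integral,
    (ae_restrict_iff' measurableSet_Icc).1 (hu.ae_diagDensity_lt_top hd ht)] with s h1 h2 hs
  refine ⟨?_, h2 (Ioo_subset_Icc_self hs)⟩
  have h3 := h1 (by rw [uIcc_of_le ht.1]; exact Ioo_subset_Icc_self hs) 0 left_mem_uIcc
  refine h3.congr_of_eventuallyEq ?_
  filter_upwards [isOpen_Ioo.mem_nhds hs] with r hr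
  exact hu.strichartzF_eq_integral hd ⟨hr.1.le, hr.2.trans ht.2⟩

theorem exists_strictMono_tendsto_of_forall_exists {T : ℝ} (hT : 0 < T) {P : ℝ → Prop}
    (h : ∀ a < T, ∃ t, a < t ∧ t < T ∧ P t) :
    ∃ t : ℕ → ℝ, StrictMono t ∧ (∀ n, t n ∈ Ioo 0 T) ∧ Tendsto t atTop (𝓝 T) ∧ ∀ n, P (t n) := by
  obtain ⟨a, ha, haT, halim⟩ := exists_seq_strictMono_tendsto' hT
  choose! g hg1 hg2 hg3 using h
  -- Choosing each term beyond both the previous term and a (n + 1) gives strict monotonicity and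
  -- convergence to T together.
  let t : ℕ → ℝ := fun n => Nat.rec (g (a 0)) (fun n r => g (max r (a (n + 1)))) n
  have htT : ∀ n, t n < T := by
    intro n
    induction n with
    | zero => exact hg2 _ (haT 0).2
    | succ n ih => exact hg2 _ (max_lt ih (haT _).2)
  have hta : ∀ n, a n < t n := by
    intro n
    cases n with
    | zero => exact hg1 _ (haT 0).2
    | succ n => exact (le_max_right _ _).trans_lt (hg1 _ (max_lt (htT n) (haT _).2))
  refine ⟨t, strictMono_nat_of_lt_succ fun n => ?_, fun n => ⟨(haT n).1.trans (hta n), htT n⟩,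
    tendsto_of_tendsto_of_tendsto_of_le_of_le halim tendsto_const_nhds (fun n => (hta n).le)
      fun n => (htT n).le, fun n => ?_⟩
  · exact (le_max_left _ _).trans_lt (hg1 _ (max_lt (htT n) (haT _).2))
  · cases n with
    | zero => exact hg3 _ (haT 0).2
    | succ n => exact hg3 _ (max_lt (htT n) (haT _).2)

/-- A strict lower bound at one time holds on a neighbourhood, hence on a set of positive measure,
which meets the full-measure set where F' equals the density. -/
theorem IsSolution.exists_deriv_strichartzF_ge (hd : 0 < d) {σ T c β a t₀ : ℝ} {u₀ : L2 d}
    {u : ℝ → L2 d} (hu : IsSolution σ T u₀ u) (ht₀ : t₀ ∈ Ioo 0 T) (ha : a < t₀)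
    (h : ENNReal.ofReal (c / (T - t₀) ^ β) < diagDensity u t₀) :
    ∃ t, a < t ∧ t < T ∧ DifferentiableAt ℝ (strichartzF u) t ∧
      c / (T - t) ^ β ≤ deriv (strichartzF u) t := by
  obtain ⟨t₁, h01, h1T⟩ := exists_between ht₀.2
  have ht₁ : t₁ ∈ Ico 0 T := ⟨(ht₀.1.trans h01).le, h1T⟩
  -- The level b separates the two sides: the density stays above it by lower semicontinuity, the
  -- threshold below it by continuity.
  obtain ⟨b, hb1, hb2⟩ := exists_between h
  have hlow : ∀ᶠ s in 𝓝 t₀, b < diagDensity u s := by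
    have hcl := (lowerSemicontinuous_eLpNorm (d := d) (ENNReal.ofReal (diagExp d))).comp
      (continuous_comp_clamp hu.continuousOn ht₁.1 ht₁.2)
    have hp : 0 < diagExp d := by linarith [two_le_diagExp hd]
    have hb3 : b ^ (diagExp d)⁻¹ < eLpNorm (u (max 0 (min t₀ t₁)))
        (ENNReal.ofReal (diagExp d)) volume := by
      rw [clamp_eq ⟨ht₀.1.le, h01.le⟩, ENNReal.rpow_inv_lt_iff hp]
      exact hb2
    filter_upwards [hcl t₀ _ hb3, isOpen_Ioo.mem_nhds (⟨ht₀.1, h01⟩ : t₀ ∈ Ioo 0 t₁)] with s hs hs'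
    simp only [Function.comp_apply] at hs
    rwa [clamp_eq (Ioo_subset_Icc_self hs'), gt_iff_lt, ENNReal.rpow_inv_lt_iff hp] at hs
  have hup : ∀ᶠ s in 𝓝 t₀, ENNReal.ofReal (c / (T - s) ^ β) < b := by
    have hpos : 0 < T - t₀ := sub_pos.2 ht₀.2
    have hc : ContinuousAt (fun s => ENNReal.ofReal (c / (T - s) ^ β)) t₀ := by
      refine ENNReal.continuous_ofReal.continuousAt.comp ?_
      refine continuousAt_const.div ?_ (Real.rpow_pos_of_pos hpos β).ne'
      exact (continuousAt_const.sub continuousAt_id).rpow_const (Or.inl hpos.ne')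
    exact hc.eventually_lt_const hb1
  have hev : ∀ᶠ s in 𝓝 t₀, s ∈ Ioo 0 t₁ ∧ a < s
      ∧ ENNReal.ofReal (c / (T - s) ^ β) < diagDensity u s := by
    filter_upwards [hlow, hup, isOpen_Ioo.mem_nhds (⟨ht₀.1, h01⟩ : t₀ ∈ Ioo 0 t₁),
      eventually_gt_nhds ha] with s h1 h2 h3 h4
    exact ⟨h3, h4, h2.trans h1⟩
  have hfreq : ∃ᵐ s, s ∈ Ioo 0 t₁ ∧ a < s
      ∧ ENNReal.ofReal (c / (T - s) ^ β) < diagDensity u s := by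
    rw [frequently_ae_iff]
    exact (Measure.measure_pos_of_mem_nhds volume hev).ne'
  obtain ⟨s, ⟨hs1, hs2, hs3⟩, hs4⟩ :=
    (hfreq.and_eventually (hu.ae_hasDerivAt_strichartzF hd ht₁)).exists
  obtain ⟨hs5, hs6⟩ := hs4 hs1
  refine ⟨s, hs2, hs1.2.trans h1T, hs5.differentiableAt, ?_⟩
  rw [hs5.deriv]
  exact (ENNReal.ofReal_le_iff_le_toReal hs6.ne).1 hs3.le

theorem exists_const_deriv_strichartzF_ge (hd : 0 < d) {ε A : ℝ} (hε : 0 < ε) (hA : 0 < A) :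
    ∃ c : ℝ, 0 < c ∧
      ∀ (σ T α : ℝ) (u₀ : L2 d) (u : ℝ → L2 d), 0 < T → IsSolution σ T u₀ u →
        (∀ t ∈ Ico 0 T, ‖u t‖ ≤ ‖u₀‖) →
        ENNReal.ofReal ε ≤ limsup
          (fun t : ℝ => supCubeMass (freqTrunc (A * kappa u₀ ε / (T - t) ^ α) (u t))
            ((T - t) ^ α)) (𝓝[<] T) →
        ∃ t : ℕ → ℝ, StrictMono t ∧ (∀ n, t n ∈ Ioo 0 T) ∧ Tendsto t atTop (𝓝 T) ∧
          ∀ n, DifferentiableAt ℝ (strichartzF u) (t n) ∧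
            c / (T - t n) ^ (2 * α) ≤ deriv (strichartzF u) (t n) := by
  obtain ⟨c, hc, H⟩ := exists_const_lt_eLpNorm_of_lt_supCubeMass hd hε hA
  refine ⟨c, hc, fun σ T α u₀ u hT hu hmass hlim => ?_⟩
  refine exists_strictMono_tendsto_of_forall_exists hT
    (P := fun t => DifferentiableAt ℝ (strichartzF u) t
      ∧ c / (T - t) ^ (2 * α) ≤ deriv (strichartzF u) t) fun a ha => ?_
  -- Halving ε makes the inequality strict, so it is attained at times arbitrarily close to T.
  have hlt : ENNReal.ofReal (ε / 2) < limsup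
      (fun t : ℝ => supCubeMass (freqTrunc (A * kappa u₀ ε / (T - t) ^ α) (u t))
        ((T - t) ^ α)) (𝓝[<] T) :=
    lt_of_lt_of_le ((ENNReal.ofReal_lt_ofReal_iff hε).2 (by linarith)) hlim
  have hfreq := frequently_lt_of_lt_limsup (by isBoundedDefault) hlt
  have hmem : Ioo (max a 0) T ∈ 𝓝[<] T := Ioo_mem_nhdsLT (max_lt ha hT)
  obtain ⟨t₀, ht₀, ht₀'⟩ := (hfreq.and_eventually hmem).exists
  have h0 : t₀ ∈ Ioo 0 T := ⟨(le_max_right _ _).trans_lt ht₀'.1, ht₀'.2⟩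
  have hpos : 0 < T - t₀ := sub_pos.2 h0.2
  refine hu.exists_deriv_strichartzF_ge hd h0 ((le_max_left _ _).trans_lt ht₀'.1) ?_
  have h1 := H (u t₀) u₀ ((T - t₀) ^ α) (Real.rpow_pos_of_pos hpos α)
    (hmass t₀ ⟨h0.1.le, h0.2⟩) ht₀
  rwa [← Real.rpow_natCast, ← Real.rpow_mul hpos.le, Nat.cast_ofNat, mul_comm α] at h1

end StrichartzDerivative

/-! ### Convolution with smooth, compactly supported real kernels. -/

section Mollify

variable {d : ℕ}

/-- The convolution of a complex function with a real kernel. -/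
noncomputable def mollify (k : Space d → ℝ) (v : Space d → ℂ) : Space d → ℂ :=
  convolution k v (ContinuousLinearMap.lsmul ℝ ℝ) volume

theorem mollify_apply (k : Space d → ℝ) (v : Space d → ℂ) (x : Space d) :
    mollify k v x = ∫ y, (k y : ℂ) * v (x - y) := by
  simp [mollify, convolution_def]

theorem mollify_congr (k : Space d → ℝ) {v w : Space d → ℂ} (h : v =ᵐ[volume] w) :
    mollify k v = mollify k w :=
  convolution_congr _ EventuallyEq.rfl h

theorem mollify_conj (k : Space d → ℝ) (v : Space d → ℂ) (x : Space d) :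
    mollify k (fun y => (starRingEnd ℂ) (v y)) x = (starRingEnd ℂ) (mollify k v x) := by
  rw [mollify_apply, mollify_apply, ← integral_conj]
  simp

section Kernel

variable {k : Space d → ℝ}

theorem mollify_add (hkc : HasCompactSupport k) (hk : Continuous k) {v w : Space d → ℂ}
    (hv : LocallyIntegrable v) (hw : LocallyIntegrable w) :
    mollify k (v + w) = mollify k v + mollify k w :=
  (hkc.convolutionExists_left _ hk hv).distrib_add (hkc.convolutionExists_left _ hk hw)

theorem continuous_mollify (hkc : HasCompactSupport k) (hk : Continuous k) {v : Space d → ℂ}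
    (hv : LocallyIntegrable v) : Continuous (mollify k v) :=
  hkc.continuous_convolution_left _ hk hv

theorem contDiff_mollify (hkc : HasCompactSupport k) (hk : ContDiff ℝ ∞ k) {v : Space d → ℂ}
    (hv : LocallyIntegrable v) : ContDiff ℝ ∞ (mollify k v) :=
  hkc.contDiff_convolution_left _ hk hv

theorem fderiv_mollify (hkc : HasCompactSupport k) (hk : ContDiff ℝ 1 k) {v : Space d → ℂ}
    (hv : LocallyIntegrable v) (x e : Space d) :
    fderiv ℝ (mollify k v) x e = mollify (fun y => fderiv ℝ k y e) v x := by
  have h := hkc.hasFDerivAt_convolution_left (ContinuousLinearMap.lsmul ℝ ℝ) hk hv x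
  have h' : HasFDerivAt (mollify k v) _ x := h
  rw [h'.fderiv, convolution_def, mollify_apply]
  have hex := (hkc.fderiv (𝕜 := ℝ)).convolutionExists_left
    ((ContinuousLinearMap.lsmul ℝ ℝ).precompL (Space d)) (hk.continuous_fderiv one_ne_zero) hv x
  rw [ContinuousLinearMap.integral_apply hex]
  simp

theorem laplacian_apply {F : Type*} [NormedAddCommGroup F] [NormedSpace ℝ F] {f : Space d → F}
    (hf : ContDiff ℝ 2 f) (x : Space d) :
    Laplacian.laplacian f x = ∑ i, fderiv ℝ (fun y => fderiv ℝ f y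
      (stdOrthonormalBasis ℝ (Space d) i)) x (stdOrthonormalBasis ℝ (Space d) i) := by
  rw [InnerProductSpace.laplacian_eq_iteratedFDeriv_stdOrthonormalBasis]
  refine Finset.sum_congr rfl fun i _ => ?_
  rw [iteratedFDeriv_two_apply]
  have hdiff : DifferentiableAt ℝ (fderiv ℝ f) x :=
    (hf.fderiv_right (m := 1) (by norm_num)).differentiable one_ne_zero x
  rw [(hdiff.hasFDerivAt.clm_apply (hasFDerivAt_const _ x)).fderiv]
  simp

theorem contDiff_fderiv_apply {n m : ℕ∞} (hk : ContDiff ℝ n k) (hmn : m + 1 ≤ n) (e : Space d) :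
    ContDiff ℝ m fun y => fderiv ℝ k y e :=
  (hk.fderiv_right (m := m) (by exact_mod_cast hmn)).clm_apply contDiff_const

theorem hasCompactSupport_fderiv_apply (hkc : HasCompactSupport k) (e : Space d) :
    HasCompactSupport fun y => fderiv ℝ k y e :=
  (hkc.fderiv (𝕜 := ℝ)).comp_left (g := fun A : Space d →L[ℝ] ℝ => A e) (by simp)

theorem contDiff_two_of_infty {F : Type*} [NormedAddCommGroup F] [NormedSpace ℝ F]
    {f : Space d → F} (hf : ContDiff ℝ ∞ f) : ContDiff ℝ 2 f :=
  mod_cast contDiff_infty.1 hf 2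

/-- Every derivative falls on the kernel, so the Laplacian in the weak equation becomes a pairing
with kernel Δk and no regularity of v is needed. -/
theorem laplacian_mollify (hkc : HasCompactSupport k) (hk : ContDiff ℝ ∞ k) {v : Space d → ℂ}
    (hv : LocallyIntegrable v) (x : Space d) :
    Laplacian.laplacian (mollify k v) x = mollify (Laplacian.laplacian k) v x := by
  have hk2 : ContDiff ℝ 2 k := contDiff_two_of_infty hk
  have h1 : ContDiff ℝ 2 (mollify k v) :=
    contDiff_two_of_infty (contDiff_mollify hkc hk hv)
  rw [laplacian_apply h1]
  have h2 : ∀ e, (fun y => fderiv ℝ (mollify k v) y e)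
      = mollify (fun y => fderiv ℝ k y e) v := fun e => by
    ext y; exact fderiv_mollify hkc (hk.of_le (by exact_mod_cast le_top)) hv y e
  have hc1 : ∀ e, ContDiff ℝ 1 fun y => fderiv ℝ k y e := fun e =>
    contDiff_fderiv_apply (n := 2) (m := 1) hk2 (by norm_num) e
  have h3 : ∀ e, fderiv ℝ (mollify (fun y => fderiv ℝ k y e) v) x e
      = ∫ y, ((fderiv ℝ (fun y => fderiv ℝ k y e) y e : ℝ) : ℂ) * v (x - y) := fun e => by
    rw [fderiv_mollify (hasCompactSupport_fderiv_apply hkc e) (hc1 e) hv, mollify_apply]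
  simp_rw [h2, h3]
  rw [mollify_apply, ← integral_finsetSum]
  · congr 1 with y
    rw [laplacian_apply hk2, ← Finset.sum_mul]
    push_cast
    rfl
  · intro i _
    set e := stdOrthonormalBasis ℝ (Space d) i
    have hex := (hasCompactSupport_fderiv_apply (hasCompactSupport_fderiv_apply hkc e)
      e).convolutionExists_left (ContinuousLinearMap.lsmul ℝ ℝ)
      (contDiff_fderiv_apply (n := 1) (m := 0) (hc1 e) (by norm_num) e).continuous hv x
    simpa [ConvolutionExistsAt] using hex

theorem fderiv_comp_neg_apply (f : Space d → ℝ) (a e : Space d) :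
    fderiv ℝ (fun y => f (-y)) a e = -fderiv ℝ f (-a) e := by
  have h := (ContinuousLinearEquiv.neg ℝ (M := Space d)).comp_right_fderiv (f := f) (x := a)
  have h' : fderiv ℝ (fun y => f (-y)) a = _ := h
  rw [h']
  simp

/-- Each of the two derivatives changes the sign under reflection. Evenness of Δk later makes the
Laplacian term real. -/
theorem laplacian_neg_of_even (hk : ContDiff ℝ ∞ k) (heven : ∀ x, k (-x) = k x) (x : Space d) :
    Laplacian.laplacian k (-x) = Laplacian.laplacian k x := by
  have hk2 : ContDiff ℝ 2 k := contDiff_two_of_infty hk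
  rw [laplacian_apply hk2, laplacian_apply hk2]
  refine Finset.sum_congr rfl fun i _ => ?_
  set e := stdOrthonormalBasis ℝ (Space d) i
  have h1 : (fun y => fderiv ℝ k (-y) e) = fun y => -fderiv ℝ k y e := by
    ext y
    have h := fderiv_comp_neg_apply k y e
    simp only [heven] at h
    rw [h, neg_neg]
  have h2 := fderiv_comp_neg_apply (fun y => fderiv ℝ k y e) x e
  rw [h1, fderiv_fun_neg] at h2
  exact (neg_injective h2).symm

theorem continuous_laplacian (hk : ContDiff ℝ ∞ k) : Continuous (Laplacian.laplacian k) := by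
  have hk2 : ContDiff ℝ 2 k := contDiff_two_of_infty hk
  have h : Laplacian.laplacian k = _ := funext fun x => laplacian_apply hk2 x
  rw [h]
  refine continuous_finsetSum _ fun i _ => ?_
  exact (contDiff_fderiv_apply (n := 1) (m := 0)
    (contDiff_fderiv_apply (n := 2) (m := 1) hk2 (by norm_num) _) (by norm_num) _).continuous

theorem hasCompactSupport_laplacian (hkc : HasCompactSupport k) :
    HasCompactSupport (Laplacian.laplacian k) := by
  refine HasCompactSupport.intro' hkc.isCompact (isClosed_tsupport k) fun x hx => ?_
  have h : k =ᶠ[𝓝 x] fun _ => (0 : ℝ) := notMem_tsupport_iff_eventuallyEq.1 hx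
  have h1 := (InnerProductSpace.laplacian_congr_nhds h).eq_of_nhds
  rw [h1, InnerProductSpace.laplacian_const]
  rfl

end Kernel

end Mollify

/-! ### Correlations of two functions and their continuity. -/

section Correlation

variable {d : ℕ}

/-- The correlation `y ↦ ∫ a(x) b(x - y) dx`. -/
noncomputable def corr (a b : Space d → ℂ) (y : Space d) : ℂ := ∫ x, a x * b (x - y)

section Fubini

variable {k : Space d → ℝ} {a b : Space d → ℂ} {C : ℝ≥0∞}

theorem aestronglyMeasurable_mollify_integrand (hk : Continuous k)
    (ha : AEStronglyMeasurable a volume) (hb : AEStronglyMeasurable b volume) :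
    AEStronglyMeasurable (fun z : Space d × Space d => a z.1 * ((k z.2 : ℂ) * b (z.1 - z.2)))
      (volume.prod volume) :=
  ha.comp_fst.mul ((Complex.continuous_ofReal.comp
    (hk.comp continuous_snd)).aestronglyMeasurable.mul
    (hb.comp_quasiMeasurePreserving (quasiMeasurePreserving_sub volume volume)))

theorem lintegral_prod_mollify_le (hk : Continuous k)
    (ha : AEStronglyMeasurable a volume) (hb : AEStronglyMeasurable b volume)
    (hC : ∀ y, ∫⁻ x, ‖a x‖ₑ * ‖b (x - y)‖ₑ ≤ C) :
    ∫⁻ z : Space d × Space d, ‖a z.1 * ((k z.2 : ℂ) * b (z.1 - z.2))‖ₑ ∂(volume.prod volume)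
      ≤ (∫⁻ y, ‖k y‖ₑ) * C := by
  rw [lintegral_prod_symm _ (aestronglyMeasurable_mollify_integrand hk ha hb).enorm,
    ← lintegral_mul_const _ hk.enorm.measurable]
  refine lintegral_mono fun y => ?_
  calc ∫⁻ x, ‖a x * ((k y : ℂ) * b (x - y))‖ₑ = ∫⁻ x, ‖k y‖ₑ * (‖a x‖ₑ * ‖b (x - y)‖ₑ) := by
        refine lintegral_congr fun x => ?_
        have : ‖(k y : ℂ)‖ₑ = ‖k y‖ₑ := by
          rw [← ofReal_norm, ← ofReal_norm, Complex.norm_real]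
        rw [enorm_mul, enorm_mul, this]
        ring
    _ = ‖k y‖ₑ * ∫⁻ x, ‖a x‖ₑ * ‖b (x - y)‖ₑ := lintegral_const_mul' _ _ enorm_ne_top
    _ ≤ ‖k y‖ₑ * C := by gcongr; exact hC y

theorem lintegral_mul_mollify_le (hk : Continuous k)
    (ha : AEStronglyMeasurable a volume) (hb : AEStronglyMeasurable b volume)
    (hC : ∀ y, ∫⁻ x, ‖a x‖ₑ * ‖b (x - y)‖ₑ ≤ C) :
    ∫⁻ x, ‖a x * mollify k b x‖ₑ ≤ (∫⁻ y, ‖k y‖ₑ) * C := by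
  refine le_trans ?_ (lintegral_prod_mollify_le hk ha hb hC)
  rw [lintegral_prod _ (aestronglyMeasurable_mollify_integrand hk ha hb).enorm]
  refine lintegral_mono fun x => ?_
  rw [mollify_apply, ← integral_const_mul]
  exact enorm_integral_le_lintegral_enorm _

theorem lintegral_enorm_kernel_lt_top (hkc : HasCompactSupport k) (hk : Continuous k) :
    ∫⁻ y, ‖k y‖ₑ < ⊤ :=
  (hk.integrable_of_hasCompactSupport hkc).2

/-- Fubini, justified by a bound on the absolute correlation uniform in the shift. As k shrinks to a
point mass, the limit is then read off from the correlation at 0. -/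
theorem integral_mul_mollify_eq (hkc : HasCompactSupport k) (hk : Continuous k)
    (ha : AEStronglyMeasurable a volume) (hb : AEStronglyMeasurable b volume)
    (hC : ∀ y, ∫⁻ x, ‖a x‖ₑ * ‖b (x - y)‖ₑ ≤ C) (hCtop : C < ⊤) :
    ∫ x, a x * mollify k b x = ∫ y, (k y : ℂ) * corr a b y := by
  have hint : Integrable (fun z : Space d × Space d =>
      a z.1 * ((k z.2 : ℂ) * b (z.1 - z.2))) (volume.prod volume) :=
    ⟨aestronglyMeasurable_mollify_integrand hk ha hb,
      (lintegral_prod_mollify_le hk ha hb hC).trans_lt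
        (ENNReal.mul_lt_top (lintegral_enorm_kernel_lt_top hkc hk) hCtop)⟩
  simp_rw [mollify_apply, corr, ← integral_const_mul]
  rw [integral_integral_swap hint]
  congr 1 with y
  congr 1 with x
  ring

end Fubini

theorem corr_neg (a b : Space d → ℂ) (y : Space d) : corr a b (-y) = corr b a y := by
  rw [corr, corr, ← integral_sub_right_eq_self _ y]
  congr 1 with x
  rw [sub_neg_eq_add, sub_add_cancel, mul_comm]

theorem measurePreserving_sub_right_space (y : Space d) :
    MeasurePreserving (fun x : Space d => x - y) volume volume :=
  measurePreserving_sub_right volume y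

theorem measurePreserving_sub_left_space (y : Space d) :
    MeasurePreserving (fun x : Space d => y - x) volume volume :=
  Measure.measurePreserving_sub_left volume y

theorem lintegral_mul_comp_le {p q : ℝ≥0∞} [p.HolderConjugate q] {a b : Space d → ℂ}
    (ha : AEStronglyMeasurable a volume) (hb : AEStronglyMeasurable b volume)
    {g : Space d → Space d} (hg : MeasurePreserving g volume volume) :
    ∫⁻ x, ‖a x‖ₑ * ‖b (g x)‖ₑ ≤ eLpNorm a p volume * eLpNorm b q volume := by
  have h := eLpNorm_smul_le_mul_eLpNorm (p := p) (q := q) (r := 1)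
    (hb.comp_measurePreserving hg) ha
  rw [eLpNorm_comp_measurePreserving hb hg, eLpNorm_one_eq_lintegral_enorm] at h
  refine le_trans (le_of_eq ?_) h
  refine lintegral_congr fun x => ?_
  simp [enorm_mul]

/-- Translation is continuous in L^q for q < ∞, and the correlation is the dual pairing of a with a
translate of b. -/
theorem continuous_corr {p q : ℝ≥0∞} [p.HolderConjugate q] [Fact (1 ≤ p)] [Fact (1 ≤ q)]
    (hq : q ≠ ⊤) {a b : Space d → ℂ} (ha : MemLp a p) (hb : MemLp b q) :
    Continuous (corr a b) := by
  let τ : Space d → C(Space d, Space d) := fun y => ⟨fun x => x - y, by fun_prop⟩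
  have hτ : Continuous τ :=
    ContinuousMap.continuous_of_continuous_uncurry _ (by
      change Continuous fun z : Space d × Space d => z.2 - z.1
      fun_prop)
  have hτm : ∀ y, MeasurePreserving (τ y) volume volume := measurePreserving_sub_right_space
  have hcont : Continuous fun y => Lp.compMeasurePreserving (τ y) (hτm y) (hb.toLp b) :=
    Continuous.compMeasurePreservingLp continuous_const hτ hτm hq
  have h2 := (((ContinuousLinearMap.mul ℂ ℂ).lpPairing volume p q) (ha.toLp a)).continuous.comp
    hcont
  refine h2.congr fun y => ?_
  rw [Function.comp_apply, ContinuousLinearMap.lpPairing_eq_integral, corr]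
  refine integral_congr_ae ?_
  filter_upwards [ha.coeFn_toLp, Lp.coeFn_compMeasurePreserving (hb.toLp b) (hτm y),
    (hτm y).quasiMeasurePreserving.ae_eq_comp hb.coeFn_toLp] with x h1 h3 h4
  rw [h1, h3, h4]
  rfl

end Correlation

/-! ### Regularised bilinear forms: bounds, symmetry and reality. -/

section Pairing

variable {d : ℕ}

/-- The bilinear form `∫ a (k ⋆ b)` on `L²`. -/
noncomputable def pair (k : Space d → ℝ) (a b : L2 d) : ℂ := ∫ x, a x * mollify k b x

/-- The form `∫ N(a) (k ⋆ b)` with the nonlinearity `N`. -/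
noncomputable def npair (k : Space d → ℝ) (a b : L2 d) : ℂ :=
  ∫ x, nonlinearity d (a x) * mollify k b x

/-- The `p`-th power of the `L^p` norm at the diagonal exponent. -/
noncomputable def diagMass (a : L2 d) : ℝ≥0∞ :=
  eLpNorm a (ENNReal.ofReal (diagExp d)) volume ^ diagExp d

theorem diagMass_eq_lintegral (hd : 0 < d) (a : L2 d) :
    diagMass a = ∫⁻ x, ‖a x‖ₑ ^ diagExp d := by
  have hp : 0 < diagExp d := by linarith [two_le_diagExp hd]
  rw [diagMass, eLpNorm_eq_lintegral_rpow_enorm_toReal (by simpa using hp) ENNReal.ofReal_ne_top,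
    ENNReal.toReal_ofReal hp.le, ← ENNReal.rpow_mul, one_div_mul_cancel hp.ne', ENNReal.rpow_one]

theorem memLp_of_diagMass_lt_top (hd : 0 < d) {a : L2 d} (ha : diagMass a < ⊤) :
    MemLp a (ENNReal.ofReal (diagExp d)) := by
  have hp : 0 < diagExp d := by linarith [two_le_diagExp hd]
  exact ⟨Lp.aestronglyMeasurable a, (ENNReal.rpow_lt_top_iff_of_pos hp).1 ha⟩

theorem continuous_nonlinearity (hd : 0 < d) : Continuous (nonlinearity d) := by
  have h : (0 : ℝ) ≤ 4 / d := by positivity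
  exact (Complex.continuous_ofReal.comp (continuous_norm.rpow_const fun _ => Or.inr h)).mul
    continuous_id

theorem enorm_nonlinearity (hd : 0 < d) (z : ℂ) :
    ‖nonlinearity d z‖ₑ = ‖z‖ₑ ^ (diagExp d - 1) := by
  have h : (0 : ℝ) ≤ 4 / d := by positivity
  have h1 : diagExp d - 1 = 4 / d + 1 := by rw [diagExp_eq hd]; ring
  rw [nonlinearity, enorm_mul, ← ofReal_norm (_ : ℂ), Complex.norm_real,
    Real.norm_of_nonneg (by positivity), ← ENNReal.ofReal_rpow_of_nonneg (norm_nonneg z) h,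
    ofReal_norm, h1, ENNReal.rpow_add_of_nonneg _ _ h zero_le_one, ENNReal.rpow_one]

theorem nonlinearity_mul_conj (z : ℂ) :
    nonlinearity d z * (starRingEnd ℂ) z = ((‖z‖ ^ (4 / (d : ℝ)) * ‖z‖ ^ 2 : ℝ) : ℂ) := by
  rw [nonlinearity, mul_assoc, Complex.mul_conj, Complex.normSq_eq_norm_sq]
  push_cast
  ring

/-- A crude Young inequality: replace both factors by the larger of x and y. -/
theorem rpow_sub_one_mul_le {p : ℝ} (hp : 1 ≤ p) (x y : ℝ≥0∞) :
    x ^ (p - 1) * y ≤ x ^ p + y ^ p := by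
  have h : ∀ z : ℝ≥0∞, z ^ (p - 1) * z = z ^ p := fun z => by
    nth_rewrite 2 [← ENNReal.rpow_one z]
    rw [← ENNReal.rpow_add_of_nonneg _ _ (by linarith) zero_le_one, sub_add_cancel]
  rcases le_total x y with hxy | hxy
  · refine le_trans ?_ le_add_self
    rw [← h y]
    gcongr
  · refine le_trans ?_ le_self_add
    rw [← h x]
    gcongr

theorem rpow_sub_one_le_add {p : ℝ} (hp : 2 ≤ p) (x : ℝ≥0∞) : x ^ (p - 1) ≤ x + x ^ p := by
  rcases le_total x 1 with hx | hx
  · refine le_trans ?_ le_self_add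
    calc x ^ (p - 1) ≤ x ^ (1 : ℝ) := ENNReal.rpow_le_rpow_of_exponent_ge hx (by linarith)
      _ = x := ENNReal.rpow_one x
  · refine le_trans ?_ le_add_self
    exact ENNReal.rpow_le_rpow_of_exponent_le hx (by linarith)

theorem lintegral_mul_comp_le_norm (a b : L2 d) {g : Space d → Space d}
    (hg : MeasurePreserving g volume volume) :
    ∫⁻ x, ‖a x‖ₑ * ‖b (g x)‖ₑ ≤ ‖a‖ₑ * ‖b‖ₑ := by
  rw [Lp.enorm_def, Lp.enorm_def]
  exact lintegral_mul_comp_le (Lp.aestronglyMeasurable a) (Lp.aestronglyMeasurable b) hg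

theorem lintegral_nonlinearity_mul_comp_le (hd : 0 < d) (a b : L2 d) {g : Space d → Space d}
    (hg : MeasurePreserving g volume volume) :
    ∫⁻ x, ‖nonlinearity d (a x)‖ₑ * ‖b (g x)‖ₑ ≤ diagMass a + diagMass b := by
  have hp := two_le_diagExp hd
  have hb : AEMeasurable (fun x => ‖b x‖ₑ ^ diagExp d) volume :=
    (Lp.aestronglyMeasurable b).enorm.pow_const _
  calc ∫⁻ x, ‖nonlinearity d (a x)‖ₑ * ‖b (g x)‖ₑ
      ≤ ∫⁻ x, (‖a x‖ₑ ^ diagExp d + ‖b (g x)‖ₑ ^ diagExp d) := by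
        refine lintegral_mono fun x => ?_
        rw [enorm_nonlinearity hd]
        exact rpow_sub_one_mul_le (by linarith) _ _
    _ = diagMass a + diagMass b := by
        rw [lintegral_add_left' ((Lp.aestronglyMeasurable a).enorm.pow_const _),
          diagMass_eq_lintegral hd, diagMass_eq_lintegral hd]
        congr 1
        rw [← lintegral_map' (f := fun x => ‖b x‖ₑ ^ diagExp d) (by rwa [hg.map_eq])
          hg.aemeasurable, hg.map_eq]

theorem aestronglyMeasurable_nonlinearity (hd : 0 < d) (a : L2 d) :
    AEStronglyMeasurable (fun x => nonlinearity d (a x)) volume :=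
  (continuous_nonlinearity hd).comp_aestronglyMeasurable (Lp.aestronglyMeasurable a)

theorem memLp_nonlinearity (hd : 0 < d) {a : L2 d} (ha : diagMass a < ⊤) :
    MemLp (fun x => nonlinearity d (a x))
      (ENNReal.ofReal (diagExp d / (diagExp d - 1))) := by
  have hp := two_le_diagExp hd
  have hq : 0 < diagExp d / (diagExp d - 1) := by
    apply div_pos <;> linarith
  refine ⟨aestronglyMeasurable_nonlinearity hd a, ?_⟩
  rw [eLpNorm_lt_top_iff_lintegral_rpow_enorm_lt_top (by simpa using hq) ENNReal.ofReal_ne_top,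
    ENNReal.toReal_ofReal hq.le]
  refine lt_of_eq_of_lt ?_ ha
  rw [diagMass_eq_lintegral hd]
  refine lintegral_congr fun x => ?_
  rw [enorm_nonlinearity hd, ← ENNReal.rpow_mul, mul_div_cancel₀]
  linarith

section Kernel

variable {k : Space d → ℝ}

theorem lintegral_pair_le (hk : Continuous k) (a b : L2 d) :
    ∫⁻ x, ‖a x * mollify k b x‖ₑ ≤ (∫⁻ y, ‖k y‖ₑ) * (‖a‖ₑ * ‖b‖ₑ) :=
  lintegral_mul_mollify_le hk (Lp.aestronglyMeasurable a) (Lp.aestronglyMeasurable b)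
    fun y => lintegral_mul_comp_le_norm a b (measurePreserving_sub_right_space y)

theorem L2.locallyIntegrable (b : L2 d) : LocallyIntegrable b :=
  (Lp.memLp b).locallyIntegrable one_le_two

theorem integrable_pair (hkc : HasCompactSupport k) (hk : Continuous k) (a b : L2 d) :
    Integrable fun x => a x * mollify k b x :=
  ⟨(Lp.aestronglyMeasurable a).mul
    (continuous_mollify hkc hk (L2.locallyIntegrable b)).aestronglyMeasurable,
    (lintegral_pair_le hk a b).trans_lt (ENNReal.mul_lt_top
      (lintegral_enorm_kernel_lt_top hkc hk) (ENNReal.mul_lt_top enorm_lt_top enorm_lt_top))⟩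

theorem enorm_mollify_le (hk : Continuous k) (b : L2 d) (x : Space d) :
    ‖mollify k b x‖ₑ ≤ eLpNorm k 2 volume * ‖b‖ₑ := by
  rw [mollify_apply]
  refine (enorm_integral_le_lintegral_enorm _).trans ?_
  have h := lintegral_mul_comp_le (p := 2) (q := 2) (a := fun y => (k y : ℂ)) (b := b)
    (Complex.continuous_ofReal.comp hk).aestronglyMeasurable (Lp.aestronglyMeasurable b)
    (measurePreserving_sub_left_space x)
  have h1 : eLpNorm (fun y => (k y : ℂ)) 2 volume = eLpNorm k 2 volume :=
    eLpNorm_congr_norm_ae (ae_of_all _ fun y => Complex.norm_real _)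
  rw [h1, ← Lp.enorm_def] at h
  simpa only [enorm_mul] using h

/-- The bound is linear in the L² norm of b, as density and error estimates require. It uses
|z|^{p-1} ≤ |z| + |z|^p: the first term is an L² pairing, the second meets the sup bound on k ⋆ b.
-/
theorem lintegral_npair_le (hd : 0 < d) (hk : Continuous k) (a b : L2 d) :
    ∫⁻ x, ‖nonlinearity d (a x) * mollify k b x‖ₑ
      ≤ ((∫⁻ y, ‖k y‖ₑ) * ‖a‖ₑ + eLpNorm k 2 volume * diagMass a) * ‖b‖ₑ := by
  calc ∫⁻ x, ‖nonlinearity d (a x) * mollify k b x‖ₑ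
      ≤ ∫⁻ x, (‖a x * mollify k b x‖ₑ
          + ‖a x‖ₑ ^ diagExp d * (eLpNorm k 2 volume * ‖b‖ₑ)) := by
        refine lintegral_mono fun x => ?_
        rw [enorm_mul, enorm_mul, enorm_nonlinearity hd]
        refine (mul_le_mul_left (rpow_sub_one_le_add (two_le_diagExp hd) _) _).trans ?_
        rw [add_mul]
        gcongr
        exact enorm_mollify_le hk b x
    _ = (∫⁻ x, ‖a x * mollify k b x‖ₑ) + diagMass a * (eLpNorm k 2 volume * ‖b‖ₑ) := by
        rw [lintegral_add_right', lintegral_mul_const'', diagMass_eq_lintegral hd]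
        · exact (Lp.aestronglyMeasurable a).enorm.pow_const _
        · exact ((Lp.aestronglyMeasurable a).enorm.pow_const _).mul_const _
    _ ≤ (∫⁻ y, ‖k y‖ₑ) * (‖a‖ₑ * ‖b‖ₑ) + diagMass a * (eLpNorm k 2 volume * ‖b‖ₑ) := by
        gcongr
        exact lintegral_pair_le hk a b
    _ = _ := by ring

theorem eLpNorm_kernel_lt_top (hkc : HasCompactSupport k) (hk : Continuous k) :
    eLpNorm k 2 volume < ⊤ :=
  (hk.memLp_of_hasCompactSupport hkc).2

theorem integrable_npair (hd : 0 < d) (hkc : HasCompactSupport k) (hk : Continuous k) {a : L2 d}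
    (ha : diagMass a < ⊤) (b : L2 d) :
    Integrable fun x => nonlinearity d (a x) * mollify k b x :=
  ⟨(aestronglyMeasurable_nonlinearity hd a).mul
    (continuous_mollify hkc hk (L2.locallyIntegrable b)).aestronglyMeasurable,
    (lintegral_npair_le hd hk a b).trans_lt (ENNReal.mul_lt_top (ENNReal.add_lt_top.2
      ⟨ENNReal.mul_lt_top (lintegral_enorm_kernel_lt_top hkc hk) enorm_lt_top,
        ENNReal.mul_lt_top (eLpNorm_kernel_lt_top hkc hk) ha⟩) enorm_lt_top)⟩

theorem mollify_L2_add (hkc : HasCompactSupport k) (hk : Continuous k) (b c : L2 d) :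
    mollify k ((b + c : L2 d) : Space d → ℂ) = mollify k b + mollify k c := by
  rw [mollify_congr k (Lp.coeFn_add b c),
    mollify_add hkc hk (L2.locallyIntegrable b) (L2.locallyIntegrable c)]

theorem pair_add_left (hkc : HasCompactSupport k) (hk : Continuous k) (a b c : L2 d) :
    pair k (a + b) c = pair k a c + pair k b c := by
  rw [pair, pair, pair, ← integral_add (integrable_pair hkc hk a c) (integrable_pair hkc hk b c)]
  refine integral_congr_ae ?_
  filter_upwards [Lp.coeFn_add a b] with x hx
  rw [hx, Pi.add_apply]; ring

theorem pair_add_right (hkc : HasCompactSupport k) (hk : Continuous k) (a b c : L2 d) :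
    pair k a (b + c) = pair k a b + pair k a c := by
  rw [pair, pair, pair, ← integral_add (integrable_pair hkc hk a b) (integrable_pair hkc hk a c),
    mollify_L2_add hkc hk]
  simp only [Pi.add_apply, mul_add]

theorem pair_sub_left (hkc : HasCompactSupport k) (hk : Continuous k) (a b c : L2 d) :
    pair k (a - b) c = pair k a c - pair k b c := by
  have h := pair_add_left hkc hk (a - b) b c
  rw [sub_add_cancel] at h
  rw [h]; ring

theorem pair_sub_right (hkc : HasCompactSupport k) (hk : Continuous k) (a b c : L2 d) :
    pair k a (b - c) = pair k a b - pair k a c := by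
  have h := pair_add_right hkc hk a (b - c) c
  rw [sub_add_cancel] at h
  rw [h]; ring

theorem npair_add (hd : 0 < d) (hkc : HasCompactSupport k) (hk : Continuous k) {a : L2 d}
    (ha : diagMass a < ⊤) (b c : L2 d) :
    npair k a (b + c) = npair k a b + npair k a c := by
  rw [npair, npair, npair, ← integral_add (integrable_npair hd hkc hk ha b)
    (integrable_npair hd hkc hk ha c), mollify_L2_add hkc hk]
  simp only [Pi.add_apply, mul_add]

theorem npair_sub (hd : 0 < d) (hkc : HasCompactSupport k) (hk : Continuous k) {a : L2 d}
    (ha : diagMass a < ⊤) (b c : L2 d) :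
    npair k a (b - c) = npair k a b - npair k a c := by
  have h := npair_add hd hkc hk ha (b - c) c
  rw [sub_add_cancel] at h
  rw [h]; ring

/-- A common bound for `pair` and `npair`. -/
noncomputable def kernelBound (k : Space d → ℝ) : ℝ :=
  (∫⁻ y, ‖k y‖ₑ).toReal + (eLpNorm k 2 volume).toReal

theorem kernelBound_nonneg (k : Space d → ℝ) : 0 ≤ kernelBound k := by
  unfold kernelBound; positivity

theorem norm_pair_le (hkc : HasCompactSupport k) (hk : Continuous k) (a b : L2 d) :
    ‖pair k a b‖ ≤ kernelBound k * ‖a‖ * ‖b‖ := by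
  have h := (enorm_integral_le_lintegral_enorm _).trans (lintegral_pair_le hk a b)
  have h1 : (∫⁻ y, ‖k y‖ₑ) * (‖a‖ₑ * ‖b‖ₑ) ≠ ⊤ := (ENNReal.mul_lt_top
      (lintegral_enorm_kernel_lt_top hkc hk) (ENNReal.mul_lt_top enorm_lt_top enorm_lt_top)).ne
  have h2 := ENNReal.toReal_mono h1 h
  rw [ENNReal.toReal_mul, ENNReal.toReal_mul, toReal_enorm, toReal_enorm, toReal_enorm] at h2
  refine h2.trans ?_
  rw [mul_assoc]
  gcongr
  exact le_add_of_nonneg_right ENNReal.toReal_nonneg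

theorem norm_npair_le (hd : 0 < d) (hkc : HasCompactSupport k) (hk : Continuous k) {a : L2 d}
    (ha : diagMass a < ⊤) (b : L2 d) :
    ‖npair k a b‖ ≤ kernelBound k * (‖a‖ + (diagMass a).toReal) * ‖b‖ := by
  have h := (enorm_integral_le_lintegral_enorm _).trans (lintegral_npair_le hd hk a b)
  have h3 := ENNReal.mul_lt_top (lintegral_enorm_kernel_lt_top hkc hk) (enorm_lt_top (x := a))
  have h4 := ENNReal.mul_lt_top (eLpNorm_kernel_lt_top hkc hk) ha
  have h1 := (ENNReal.mul_lt_top (ENNReal.add_lt_top.2 ⟨h3, h4⟩) (enorm_lt_top (x := b))).ne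
  have h2 := ENNReal.toReal_mono h1 h
  rw [ENNReal.toReal_mul, ENNReal.toReal_add h3.ne h4.ne, ENNReal.toReal_mul, ENNReal.toReal_mul,
    toReal_enorm, toReal_enorm, toReal_enorm] at h2
  refine h2.trans ?_
  rw [mul_add]
  gcongr
  · exact le_add_of_nonneg_right ENNReal.toReal_nonneg
  · exact le_add_of_nonneg_left ENNReal.toReal_nonneg

theorem pair_eq_integral_corr (hkc : HasCompactSupport k) (hk : Continuous k) (a b : L2 d) :
    pair k a b = ∫ y, (k y : ℂ) * corr a b y :=
  integral_mul_mollify_eq hkc hk (Lp.aestronglyMeasurable a) (Lp.aestronglyMeasurable b)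
    (fun y => lintegral_mul_comp_le_norm a b (measurePreserving_sub_right_space y))
    (ENNReal.mul_lt_top enorm_lt_top enorm_lt_top)

theorem npair_eq_integral_corr (hd : 0 < d) (hkc : HasCompactSupport k) (hk : Continuous k)
    {a b : L2 d} (ha : diagMass a < ⊤) (hb : diagMass b < ⊤) :
    npair k a b = ∫ y, (k y : ℂ) * corr (fun x => nonlinearity d (a x)) b y :=
  integral_mul_mollify_eq hkc hk (aestronglyMeasurable_nonlinearity hd a)
    (Lp.aestronglyMeasurable b)
    (fun y => lintegral_nonlinearity_mul_comp_le hd a b (measurePreserving_sub_right_space y))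
    (ENNReal.add_lt_top.2 ⟨ha, hb⟩)

/-- Exchanging a and b reflects the correlation, which an even kernel does not see. -/
theorem pair_comm (hkc : HasCompactSupport k) (hk : Continuous k) (heven : ∀ x, k (-x) = k x)
    (a b : L2 d) : pair k a b = pair k b a := by
  rw [pair_eq_integral_corr hkc hk, pair_eq_integral_corr hkc hk, ← integral_neg_eq_self]
  congr 1 with y
  rw [heven, corr_neg]

theorem conj_pair (a b : L2 d) : (starRingEnd ℂ) (pair k a b) = pair k (star a) (star b) := by
  rw [pair, pair, ← integral_conj, mollify_congr k (Lp.coeFn_star b)]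
  refine integral_congr_ae ?_
  filter_upwards [Lp.coeFn_star a] with x hx
  rw [hx, map_mul, ← mollify_conj]
  rfl

theorem pair_star_im (hkc : HasCompactSupport k) (hk : Continuous k) (heven : ∀ x, k (-x) = k x)
    (a : L2 d) : (pair k a (star a)).im = 0 := by
  have h := conj_pair (k := k) a (star a)
  rw [star_star] at h
  exact Complex.conj_eq_iff_im.1 (h.trans (pair_comm hkc hk heven _ _))

end Kernel

end Pairing

/-! ### Shrinking mollifiers and measurability in time. -/

section TimeMeasurability

variable {d : ℕ}

/-- A shrinking sequence of bump functions at the origin. -/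
noncomputable def shrinkingBump (d n : ℕ) : ContDiffBump (0 : Space d) where
  rIn := 1 / ((n : ℝ) + 1)
  rOut := 2 * (1 / ((n : ℝ) + 1))
  rIn_pos := Nat.one_div_pos_of_nat
  rIn_lt_rOut := by
    have : (0 : ℝ) < 1 / ((n : ℝ) + 1) := Nat.one_div_pos_of_nat
    linarith

theorem tendsto_shrinkingBump_rOut (d : ℕ) :
    Tendsto (fun n => (shrinkingBump d n).rOut) atTop (𝓝 0) := by
  have h := (tendsto_one_div_add_atTop_nhds_zero_nat (𝕜 := ℝ)).const_mul 2
  rwa [mul_zero] at h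

/-- The normalized even mollifier. -/
noncomputable def mollifier (d n : ℕ) : Space d → ℝ := (shrinkingBump d n).normed volume

theorem contDiff_mollifier (d n : ℕ) : ContDiff ℝ ∞ (mollifier d n) :=
  (shrinkingBump d n).contDiff_normed

theorem hasCompactSupport_mollifier (d n : ℕ) : HasCompactSupport (mollifier d n) :=
  (shrinkingBump d n).hasCompactSupport_normed

theorem mollifier_neg (d n : ℕ) (x : Space d) : mollifier d n (-x) = mollifier d n x :=
  (shrinkingBump d n).normed_neg x

theorem continuous_mollifier (d n : ℕ) : Continuous (mollifier d n) :=
  (contDiff_mollifier d n).continuous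

theorem lintegral_mollifier (d n : ℕ) : ∫⁻ y, ‖mollifier d n y‖ₑ = 1 := by
  have h : ∀ y, ‖mollifier d n y‖ₑ = ENNReal.ofReal (mollifier d n y) := fun y =>
    Real.enorm_eq_ofReal ((shrinkingBump d n).nonneg_normed y)
  simp_rw [h]
  rw [← ofReal_integral_eq_lintegral_ofReal
    ((continuous_mollifier d n).integrable_of_hasCompactSupport (hasCompactSupport_mollifier d n))
    (ae_of_all _ fun y => (shrinkingBump d n).nonneg_normed y)]
  rw [show ∫ y, mollifier d n y = 1 from (shrinkingBump d n).integral_normed, ENNReal.ofReal_one]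

theorem tendsto_integral_mollifier_mul {c : Space d → ℂ} (hc : Continuous c) :
    Tendsto (fun n => ∫ y, (mollifier d n y : ℂ) * c y) atTop (𝓝 (c 0)) := by
  have h := ContDiffBump.convolution_tendsto_right_of_continuous (μ := (volume : Measure (Space d)))
    (tendsto_shrinkingBump_rOut d) (hc.comp continuous_neg) 0
  simp only [Function.comp_apply, neg_zero] at h
  refine h.congr fun n => ?_
  rw [convolution_def]
  simp [mollifier]

theorem ae_tendsto_mollify {v : Space d → ℂ} (hv : LocallyIntegrable v) :
    ∀ᵐ x, Tendsto (fun n => mollify (mollifier d n) v x) atTop (𝓝 (v x)) :=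
  ContDiffBump.ae_convolution_tendsto_right_of_locallyIntegrable (K := 2)
    (tendsto_shrinkingBump_rOut d) (Eventually.of_forall fun _ => le_rfl) hv

theorem continuous_mollify_eval {k : Space d → ℝ} (hkc : HasCompactSupport k) (hk : Continuous k)
    (x : Space d) : Continuous fun b : L2 d => mollify k b x := by
  let K : NNReal := (eLpNorm k 2 volume).toNNReal
  have hK : (K : ℝ≥0∞) = eLpNorm k 2 volume :=
    ENNReal.coe_toNNReal (eLpNorm_kernel_lt_top hkc hk).ne
  refine LipschitzWith.continuous (K := K) fun b c => ?_
  have h := mollify_L2_add hkc hk (b - c) c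
  rw [sub_add_cancel] at h
  rw [edist_eq_enorm_sub, edist_eq_enorm_sub, h, hK, Pi.add_apply, add_sub_cancel_right]
  exact enorm_mollify_le hk (b - c) x

/-- Each v s is only a class of functions of x. Its mollifications are continuous in s and in x
separately, hence jointly measurable, and their pointwise limit recovers v s almost everywhere. -/
theorem exists_stronglyMeasurable_version {v : ℝ → L2 d} (hv : Continuous v) :
    ∃ U : ℝ × Space d → ℂ, StronglyMeasurable U ∧ ∀ s, (fun x => U (s, x)) =ᵐ[volume] v s := by
  let Un : ℕ → ℝ × Space d → ℂ :=
    fun n => Function.uncurry fun s x => mollify (mollifier d n) (v s) x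
  have hUn : ∀ n, StronglyMeasurable (Un n) := fun n =>
    stronglyMeasurable_uncurry_of_continuous_of_stronglyMeasurable
      (fun x => (continuous_mollify_eval (hasCompactSupport_mollifier d n)
        (continuous_mollifier d n) x).comp hv)
      fun s => (continuous_mollify (hasCompactSupport_mollifier d n) (continuous_mollifier d n)
        (L2.locallyIntegrable (v s))).stronglyMeasurable
  refine ⟨fun z => limUnder atTop fun n => Un n z, StronglyMeasurable.limUnder hUn, fun s => ?_⟩
  filter_upwards [ae_tendsto_mollify (L2.locallyIntegrable (v s))] with x hx
  exact hx.limUnder_eq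

/-- Finiteness of `diagMass` at a given time is not assumed, so measurability comes from integrating
jointly measurable versions rather than from continuity in time. -/
theorem stronglyMeasurable_npair (hd : 0 < d) {k : Space d → ℝ} (hk : Continuous k)
    {v w : ℝ → L2 d} (hv : Continuous v) (hw : Continuous w) :
    StronglyMeasurable fun s => npair k (v s) (w s) := by
  obtain ⟨U, hU, hUv⟩ := exists_stronglyMeasurable_version hv
  obtain ⟨W, hW, hWw⟩ := exists_stronglyMeasurable_version hw
  have h1 : StronglyMeasurable fun z : ℝ × Space d => ∫ y, (k y : ℂ) * W (z.1, z.2 - y) := by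
    refine StronglyMeasurable.integral_prod_right' (f := fun q : (ℝ × Space d) × Space d =>
      (k q.2 : ℂ) * W (q.1.1, q.1.2 - q.2)) ?_
    refine StronglyMeasurable.mul ?_ ?_
    · exact (Complex.continuous_ofReal.comp (hk.comp continuous_snd)).stronglyMeasurable
    · exact hW.comp_measurable (by fun_prop)
  have h2 : StronglyMeasurable fun z : ℝ × Space d =>
      nonlinearity d (U z) * ∫ y, (k y : ℂ) * W (z.1, z.2 - y) :=
    ((continuous_nonlinearity hd).comp_stronglyMeasurable hU).mul h1
  have h3 := StronglyMeasurable.integral_prod_right' (ν := (volume : Measure (Space d))) h2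
  convert h3 using 1
  ext s
  rw [npair, mollify_congr k (hWw s).symm]
  refine integral_congr_ae ?_
  filter_upwards [hUv s] with x hx
  rw [mollify_apply, ← hx]

end TimeMeasurability

/-! ### The weak equation tested against mollified L² functions. -/

section WeakEquation

variable {d : ℕ}

theorem eq_zero_of_forall_compactlySupported {E : L2 d → ℂ} {C : ℝ}
    (hsub : ∀ b c, E (b - c) = E b - E c) (hC : ∀ b, ‖E b‖ ≤ C * ‖b‖)
    (h : ∀ (g : Space d → ℂ) (hg : MemLp g 2), HasCompactSupport g → E (hg.toLp g) = 0)
    (b : L2 d) : E b = 0 := by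
  by_contra hne
  have hpos : 0 < ‖E b‖ := norm_pos_iff.2 hne
  have hC' : 0 < |C| + 1 := by positivity
  -- At this distance the bound on E gives ‖E b‖ ≤ ‖E b‖ / 2, a contradiction.
  obtain ⟨g, hgc, hg, -, hgm⟩ := (Lp.memLp b).exists_hasCompactSupport_eLpNorm_sub_le
    (by norm_num) (ε := ENNReal.ofReal (‖E b‖ / (2 * (|C| + 1))))
    (by simpa using by positivity)
  have h1 : ‖b - hgm.toLp g‖ ≤ ‖E b‖ / (2 * (|C| + 1)) := by
    have h2 : ‖b - hgm.toLp g‖ₑ = eLpNorm ((b : Space d → ℂ) - g) 2 volume := by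
      rw [Lp.enorm_def]
      refine eLpNorm_congr_ae ?_
      filter_upwards [Lp.coeFn_sub b (hgm.toLp g), hgm.coeFn_toLp] with x hx hx'
      rw [hx, Pi.sub_apply, Pi.sub_apply, hx']
    rw [← h2, ← ofReal_norm] at hg
    exact (ENNReal.ofReal_le_ofReal_iff (by positivity)).1 hg
  have h3 := hC (b - hgm.toLp g)
  rw [hsub, h g hgm hgc, sub_zero] at h3
  have h4 : C * ‖b - hgm.toLp g‖ ≤ (|C| + 1) * (‖E b‖ / (2 * (|C| + 1))) := by
    have : C ≤ |C| + 1 := by linarith [le_abs_self C]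
    gcongr
  have h5 : (|C| + 1) * (‖E b‖ / (2 * (|C| + 1))) = ‖E b‖ / 2 := by field_simp
  linarith

theorem continuous_pair {k : Space d → ℝ} (hkc : HasCompactSupport k) (hk : Continuous k)
    {v w : ℝ → L2 d} (hv : Continuous v) (hw : Continuous w) :
    Continuous fun s => pair k (v s) (w s) := by
  rw [continuous_iff_continuousAt]
  intro s₀
  rw [ContinuousAt, tendsto_iff_norm_sub_tendsto_zero]
  have hlim : Tendsto (fun s => kernelBound k * ‖v s - v s₀‖ * ‖w s‖
      + kernelBound k * ‖v s₀‖ * ‖w s - w s₀‖) (𝓝 s₀) (𝓝 0) := by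
    have hc : Continuous (fun s => kernelBound k * ‖v s - v s₀‖ * ‖w s‖
      + kernelBound k * ‖v s₀‖ * ‖w s - w s₀‖) := by fun_prop
    have := hc.tendsto s₀
    simpa using this
  refine squeeze_zero (fun _ => norm_nonneg _) (fun s => ?_) hlim
  have h : pair k (v s) (w s) - pair k (v s₀) (w s₀)
      = pair k (v s - v s₀) (w s) + pair k (v s₀) (w s - w s₀) := by
    rw [pair_sub_left hkc hk, pair_sub_right hkc hk]; ring
  rw [h]
  exact (norm_add_le _ _).trans
    (add_le_add (norm_pair_le hkc hk _ _) (norm_pair_le hkc hk _ _))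

variable {σ T : ℝ} {u₀ : L2 d} {u : ℝ → L2 d} {k : Space d → ℝ}

theorem IsSolution.intervalIntegrable_pair (hu : IsSolution σ T u₀ u) (hkc : HasCompactSupport k)
    (hk : Continuous k) {w : ℝ → L2 d} (hw : ContinuousOn w (Ico 0 T)) {t : ℝ}
    (ht : t ∈ Ico 0 T) :
    IntervalIntegrable (fun s => pair k (u s) (w s)) volume 0 t := by
  have h := continuous_pair hkc hk (continuous_comp_clamp hu.continuousOn ht.1 ht.2)
    (continuous_comp_clamp hw ht.1 ht.2)
  refine (h.intervalIntegrable 0 t).congr fun s hs => ?_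
  rw [uIoc_of_le ht.1] at hs
  simp only [clamp_eq (Ioc_subset_Icc_self hs)]

theorem IsSolution.ae_diagMass_lt_top (hd : 0 < d) (hu : IsSolution σ T u₀ u) {t : ℝ}
    (ht : t ∈ Ico 0 T) : ∀ᵐ s, s ∈ uIoc 0 t → diagMass (u s) < ⊤ := by
  filter_upwards [(ae_restrict_iff' measurableSet_Icc).1 (hu.ae_diagDensity_lt_top hd ht)]
    with s hs hs'
  rw [uIoc_of_le ht.1] at hs'
  exact hs (Ioc_subset_Icc_self hs')

theorem ContinuousOn.intervalIntegrable_norm_of_Ico {w : ℝ → L2 d} (hw : ContinuousOn w (Ico 0 T))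
    {t : ℝ} (ht : t ∈ Ico 0 T) : IntervalIntegrable (fun s => ‖w s‖) volume 0 t := by
  refine ContinuousOn.intervalIntegrable ?_
  rw [uIcc_of_le ht.1]
  exact hw.norm.mono (Icc_subset_Ico_right ht.2)

theorem IsSolution.intervalIntegrable_weight (hd : 0 < d) (hu : IsSolution σ T u₀ u) {t : ℝ}
    (ht : t ∈ Ico 0 T) :
    IntervalIntegrable (fun s => ‖u s‖ + (diagMass (u s)).toReal) volume 0 t :=
  (hu.continuousOn.intervalIntegrable_norm_of_Ico ht).add (hu.intervalIntegrable_diagDensity hd ht)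

theorem IsSolution.aestronglyMeasurable_npair (hd : 0 < d) (hu : IsSolution σ T u₀ u)
    (hk : Continuous k) {w : ℝ → L2 d} (hw : ContinuousOn w (Ico 0 T)) {t : ℝ}
    (ht : t ∈ Ico 0 T) :
    AEStronglyMeasurable (fun s => npair k (u s) (w s)) (volume.restrict (uIoc 0 t)) := by
  have h := stronglyMeasurable_npair hd hk (continuous_comp_clamp hu.continuousOn ht.1 ht.2)
    (continuous_comp_clamp hw ht.1 ht.2)
  refine h.aestronglyMeasurable.congr ?_
  rw [uIoc_of_le ht.1]
  filter_upwards [ae_restrict_mem measurableSet_Ioc] with s hs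
  simp only [clamp_eq (Ioc_subset_Icc_self hs)]

theorem IsSolution.intervalIntegrable_npair (hd : 0 < d) (hu : IsSolution σ T u₀ u)
    (hkc : HasCompactSupport k) (hk : Continuous k) {w : ℝ → L2 d}
    (hw : ContinuousOn w (Ico 0 T)) {t : ℝ} (ht : t ∈ Ico 0 T) :
    IntervalIntegrable (fun s => npair k (u s) (w s)) volume 0 t := by
  obtain ⟨B, hB⟩ := isCompact_Icc.exists_bound_of_continuousOn
    (hw.mono (Icc_subset_Ico_right ht.2))
  refine ((hu.intervalIntegrable_weight hd ht).const_mul (kernelBound k) |>.mul_const B).mono_fun'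
    (hu.aestronglyMeasurable_npair hd hk hw ht) ?_
  refine (ae_restrict_iff' measurableSet_uIoc).2 ?_
  filter_upwards [hu.ae_diagMass_lt_top hd ht] with s hs hs'
  refine (norm_npair_le hd hkc hk (hs hs') (w s)).trans ?_
  have := kernelBound_nonneg k
  rw [uIoc_of_le ht.1] at hs'
  gcongr
  exact hB s (Ioc_subset_Icc_self hs')

/-- For compactly supported g the function k ⋆ g is an admissible test function. The defect of the
identity is additive and bounded in b, so density extends the identity to all of L². -/
theorem IsSolution.weak_eq_pair (hd : 0 < d) (hu : IsSolution σ T u₀ u)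
    (hkc : HasCompactSupport k) (hk : ContDiff ℝ ∞ k) {t : ℝ} (ht : t ∈ Ico 0 T) (b : L2 d) :
    Complex.I * (pair k (u t) b - pair k u₀ b)
        + ∫ s in (0 : ℝ)..t, pair (Laplacian.laplacian k) (u s) b
      = (σ : ℂ) * ∫ s in (0 : ℝ)..t, npair k (u s) b := by
  have hkcont := hk.continuous
  have hΔ := continuous_laplacian hk
  have hΔc := hasCompactSupport_laplacian hkc
  have hcst : ∀ b : L2 d, ContinuousOn (fun _ : ℝ => b) (Ico 0 T) := fun b => continuousOn_const
  have hI1 := fun b => hu.intervalIntegrable_pair hΔc hΔ (hcst b) ht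
  have hI2 := fun b => hu.intervalIntegrable_npair hd hkc hkcont (hcst b) ht
  set E : L2 d → ℂ := fun b => Complex.I * (pair k (u t) b - pair k u₀ b)
    + (∫ s in (0 : ℝ)..t, pair (Laplacian.laplacian k) (u s) b)
    - (σ : ℂ) * ∫ s in (0 : ℝ)..t, npair k (u s) b with hE
  suffices h : E b = 0 from sub_eq_zero.1 h
  set C₁ := ∫ s in (0 : ℝ)..t, kernelBound (Laplacian.laplacian k) * ‖u s‖ with hC₁
  set C₂ := ∫ s in (0 : ℝ)..t, kernelBound k * (‖u s‖ + (diagMass (u s)).toReal) with hC₂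
  refine eq_zero_of_forall_compactlySupported
    (C := kernelBound k * ‖u t‖ + kernelBound k * ‖u₀‖ + C₁ + |σ| * C₂) ?_ ?_ ?_ b
  · intro b c
    have h1 : ∫ s in (0 : ℝ)..t, pair (Laplacian.laplacian k) (u s) (b - c)
        = (∫ s in (0 : ℝ)..t, pair (Laplacian.laplacian k) (u s) b)
          - ∫ s in (0 : ℝ)..t, pair (Laplacian.laplacian k) (u s) c := by
      rw [← intervalIntegral.integral_sub (hI1 b) (hI1 c)]
      exact intervalIntegral.integral_congr fun s _ => pair_sub_right hΔc hΔ _ _ _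
    have h2 : ∫ s in (0 : ℝ)..t, npair k (u s) (b - c)
        = (∫ s in (0 : ℝ)..t, npair k (u s) b) - ∫ s in (0 : ℝ)..t, npair k (u s) c := by
      rw [← intervalIntegral.integral_sub (hI2 b) (hI2 c)]
      refine intervalIntegral.integral_congr_ae ?_
      filter_upwards [hu.ae_diagMass_lt_top hd ht] with s hs hs'
      exact npair_sub hd hkc hkcont (hs hs') _ _
    simp only [hE, h1, h2, pair_sub_right hkc hkcont]
    ring
  · intro b
    have h1 : ‖∫ s in (0 : ℝ)..t, pair (Laplacian.laplacian k) (u s) b‖ ≤ C₁ * ‖b‖ := by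
      rw [hC₁, ← intervalIntegral.integral_mul_const]
      refine intervalIntegral.norm_integral_le_of_norm_le ht.1
        (ae_of_all _ fun s _ => norm_pair_le hΔc hΔ _ _) ?_
      exact ((hu.continuousOn.intervalIntegrable_norm_of_Ico ht).const_mul _).mul_const _
    have h2 : ‖∫ s in (0 : ℝ)..t, npair k (u s) b‖ ≤ C₂ * ‖b‖ := by
      rw [hC₂, ← intervalIntegral.integral_mul_const]
      refine intervalIntegral.norm_integral_le_of_norm_le ht.1 ?_ ?_
      · filter_upwards [hu.ae_diagMass_lt_top hd ht] with s hs hs'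
        exact norm_npair_le hd hkc hkcont (hs (by rwa [uIoc_of_le ht.1])) _
      · exact ((hu.intervalIntegrable_weight hd ht).const_mul _).mul_const _
    calc ‖E b‖ ≤ ‖Complex.I * (pair k (u t) b - pair k u₀ b)‖
          + ‖∫ s in (0 : ℝ)..t, pair (Laplacian.laplacian k) (u s) b‖
          + ‖(σ : ℂ) * ∫ s in (0 : ℝ)..t, npair k (u s) b‖ :=
          (norm_sub_le _ _).trans (by gcongr; exact norm_add_le _ _)
      _ ≤ (kernelBound k * ‖u t‖ * ‖b‖ + kernelBound k * ‖u₀‖ * ‖b‖) + C₁ * ‖b‖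
          + |σ| * (C₂ * ‖b‖) := by
          rw [norm_mul, norm_mul, Complex.norm_I, one_mul, Complex.norm_real, Real.norm_eq_abs]
          gcongr
          exact (norm_sub_le _ _).trans
            (add_le_add (norm_pair_le hkc hkcont _ _) (norm_pair_le hkc hkcont _ _))
      _ = _ := by ring
  · intro g hg hgc
    have hgl : LocallyIntegrable g := hg.locallyIntegrable one_le_two
    have hm : ∀ k' : Space d → ℝ, mollify k' (hg.toLp g) = mollify k' g := fun k' =>
      mollify_congr k' hg.coeFn_toLp
    have h := hu.weak_eq (mollify k g) (contDiff_mollify hkc hk hgl) (hkc.convolution _ hgc) t ht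
    have hL : Laplacian.laplacian (mollify k g) = mollify (Laplacian.laplacian k) g :=
      funext fun x => laplacian_mollify hkc hk hgl x
    rw [hL] at h
    simp only [hE, pair, npair, hm]
    exact sub_eq_zero.2 h

end WeakEquation

/-! ### Conservation of mass. -/

section MassConservation

variable {d : ℕ}

/-- Telescope over a partition of mesh below δ: the total change is at most η times a fixed number,
for every η > 0. -/
theorem eq_of_forall_small_increment {D K : ℝ → ℝ} {t₁ : ℝ} (ht₁ : 0 ≤ t₁)
    (h : ∀ η > 0, ∃ δ > 0, ∀ s t, 0 ≤ s → s ≤ t → t ≤ t₁ → t - s < δ →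
      |D t - D s| ≤ η * (K t - K s)) : D t₁ = D 0 := by
  have key : ∀ η > 0, |D t₁ - D 0| ≤ η * (K t₁ - K 0) := by
    intro η hη
    obtain ⟨δ, hδ, H⟩ := h η hη
    obtain ⟨n, hn⟩ := exists_nat_gt (t₁ / δ)
    have hn0 : (0 : ℝ) < n := lt_of_le_of_lt (by positivity) hn
    have hstep : ∀ i : ℕ, i < n → |D ((i + 1 : ℕ) * (t₁ / n)) - D (i * (t₁ / n))|
        ≤ η * (K ((i + 1 : ℕ) * (t₁ / n)) - K (i * (t₁ / n))) := by
      intro i hi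
      refine H _ _ (by positivity) ?_ ?_ ?_
      · gcongr
        omega
      · calc ((i + 1 : ℕ) : ℝ) * (t₁ / n) ≤ n * (t₁ / n) := by
              gcongr
              exact hi
          _ = t₁ := mul_div_cancel₀ _ hn0.ne'
      · rw [← sub_mul]
        push_cast
        rw [add_sub_cancel_left, one_mul, div_lt_iff₀ hn0, mul_comm, ← div_lt_iff₀ hδ]
        exact hn
    have h1 : D t₁ - D 0
        = ∑ i ∈ Finset.range n, (D ((i + 1 : ℕ) * (t₁ / n)) - D (i * (t₁ / n))) := by
      rw [Finset.sum_range_sub (fun i : ℕ => D (i * (t₁ / n))), mul_div_cancel₀ _ hn0.ne']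
      simp
    have h2 : K t₁ - K 0
        = ∑ i ∈ Finset.range n, (K ((i + 1 : ℕ) * (t₁ / n)) - K (i * (t₁ / n))) := by
      rw [Finset.sum_range_sub (fun i : ℕ => K (i * (t₁ / n))), mul_div_cancel₀ _ hn0.ne']
      simp
    rw [h1, h2, Finset.mul_sum]
    exact (Finset.abs_sum_le_sum_abs _ _).trans
      (Finset.sum_le_sum fun i hi => hstep i (Finset.mem_range.1 hi))
  have hlim : Tendsto (fun η : ℝ => η * (K t₁ - K 0)) (𝓝[>] 0) (𝓝 0) := by
    have : Tendsto (fun η : ℝ => η * (K t₁ - K 0)) (𝓝 0) (𝓝 (0 * (K t₁ - K 0))) :=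
      tendsto_id.mul_const _
    rw [zero_mul] at this
    exact this.mono_left nhdsWithin_le_nhds
  have h0 := ge_of_tendsto hlim (eventually_mem_nhdsWithin.mono fun η hη => key η hη)
  exact sub_eq_zero.1 (abs_nonpos_iff.1 h0)

variable {σ T : ℝ} {u₀ : L2 d} {u : ℝ → L2 d} {k : Space d → ℝ}

theorem L2.star_add (a b : L2 d) : star (a + b) = star a + star b := by
  refine Lp.ext ?_
  filter_upwards [Lp.coeFn_star (a + b), Lp.coeFn_add a b, Lp.coeFn_add (star a) (star b),
    Lp.coeFn_star a, Lp.coeFn_star b] with x h1 h2 h3 h4 h5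
  rw [h1, h3, Pi.star_apply, h2, Pi.add_apply, Pi.add_apply, h4, h5]
  exact StarAddMonoid.star_add _ _

theorem L2.star_sub (a b : L2 d) : star (a - b) = star a - star b := by
  rw [eq_sub_iff_add_eq, ← L2.star_add, sub_add_cancel]

theorem L2.norm_star (a : L2 d) : ‖star a‖ = ‖a‖ := by
  rw [Lp.norm_def, Lp.norm_def]
  congr 1
  refine eLpNorm_congr_norm_ae ?_
  filter_upwards [Lp.coeFn_star a] with x hx
  rw [hx, Pi.star_apply, _root_.norm_star]

theorem L2.continuous_star : Continuous fun a : L2 d => star a := by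
  refine (Isometry.of_dist_eq fun a b => ?_).continuous
  rw [dist_eq_norm, dist_eq_norm, ← L2.star_sub, L2.norm_star]

/-- Polarisation: the two cross terms are complex conjugates, so their real parts cancel. -/
theorem re_pair_sub_star_add (hkc : HasCompactSupport k) (hk : Continuous k)
    (heven : ∀ x, k (-x) = k x) (a b : L2 d) :
    (pair k a (star (a + b)) - pair k b (star (a + b))).re
      = (pair k a (star a)).re - (pair k b (star b)).re := by
  have h : (starRingEnd ℂ) (pair k a (star b)) = pair k b (star a) := by
    rw [conj_pair, star_star, pair_comm hkc hk heven]
  have h1 := congrArg Complex.re h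
  rw [Complex.conj_re] at h1
  rw [L2.star_add, pair_add_right hkc hk, pair_add_right hkc hk]
  simp only [Complex.sub_re, Complex.add_re]
  linarith

theorem norm_star_add_sub_le (a b c : L2 d) :
    ‖star (a + b) - star c - star c‖ ≤ ‖a - c‖ + ‖b - c‖ := by
  have h : star (a + b) - star c - star c = star (a - c) + star (b - c) := by
    rw [L2.star_add, L2.star_sub, L2.star_sub]; abel
  rw [h]
  refine (norm_add_le _ _).trans_eq ?_
  rw [L2.norm_star, L2.norm_star]

/-- If a and b are near c, then a + b is near 2c, and the form at (c, c̄) is real. -/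
theorem abs_im_pair_le (hkc : HasCompactSupport k) (hk : Continuous k)
    (heven : ∀ x, k (-x) = k x) (a b c : L2 d) :
    |(pair k c (star (a + b))).im| ≤ kernelBound k * ‖c‖ * (‖a - c‖ + ‖b - c‖) := by
  have h : (pair k c (star (a + b))).im = (pair k c (star (a + b) - star c - star c)).im := by
    rw [pair_sub_right hkc hk, pair_sub_right hkc hk, Complex.sub_im, Complex.sub_im,
      pair_star_im hkc hk heven]
    ring
  rw [h]
  refine (Complex.abs_im_le_norm _).trans ((norm_pair_le hkc hk _ _).trans ?_)
  have := kernelBound_nonneg k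
  gcongr
  exact norm_star_add_sub_le a b c

theorem abs_im_npair_sub_le (hd : 0 < d) (hkc : HasCompactSupport k) (hk : Continuous k)
    (a b : L2 d) {c : L2 d} (hc : diagMass c < ⊤) :
    |(npair k c (star (a + b))).im - 2 * (npair k c (star c)).im|
      ≤ kernelBound k * (‖c‖ + (diagMass c).toReal) * (‖a - c‖ + ‖b - c‖) := by
  have h : (npair k c (star (a + b))).im - 2 * (npair k c (star c)).im
      = (npair k c (star (a + b) - star c - star c)).im := by
    rw [npair_sub hd hkc hk hc, npair_sub hd hkc hk hc, Complex.sub_im, Complex.sub_im]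
    ring
  rw [h]
  refine (Complex.abs_im_le_norm _).trans ((norm_npair_le hd hkc hk hc _).trans ?_)
  have := kernelBound_nonneg k
  gcongr
  exact norm_star_add_sub_le a b c

theorem intervalIntegral_im {f : ℝ → ℂ} {a b : ℝ} (hf : IntervalIntegrable f volume a b) :
    (∫ s in a..b, f s).im = ∫ s in a..b, (f s).im := by
  have h := Complex.imCLM.intervalIntegral_comp_comm hf
  simpa using h.symm

theorem IntervalIntegrable.im {f : ℝ → ℂ} {a b : ℝ} (hf : IntervalIntegrable f volume a b) :
    IntervalIntegrable (fun s => (f s).im) volume a b :=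
  ⟨Complex.imCLM.integrable_comp hf.1, Complex.imCLM.integrable_comp hf.2⟩

theorem IsSolution.continuousOn_star (hu : IsSolution σ T u₀ u) :
    ContinuousOn (fun s => star (u s)) (Ico 0 T) :=
  L2.continuous_star.comp_continuousOn hu.continuousOn

/-- The test function uses the conjugate of u(t) + u(s), constant in time: the boundary terms become
the increment of a quadratic form, and the integrals differ from their values at u(τ) by at most r₀
times the weight. -/
theorem IsSolution.abs_increment_le (hd : 0 < d) (hu : IsSolution σ T u₀ u)
    (hkc : HasCompactSupport k) (hk : ContDiff ℝ ∞ k) (heven : ∀ x, k (-x) = k x)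
    {s t r₀ : ℝ} (hs : s ∈ Ico 0 T) (ht : t ∈ Ico 0 T) (hst : s ≤ t)
    (hω : ∀ τ ∈ Icc s t, ‖u t - u τ‖ + ‖u s - u τ‖ ≤ r₀) :
    |(pair k (u t) (star (u t))).re - (pair k (u s) (star (u s))).re
        - 2 * σ * ∫ τ in s..t, (npair k (u τ) (star (u τ))).im|
      ≤ r₀ * ∫ τ in s..t, (kernelBound (Laplacian.laplacian k) + |σ| * kernelBound k)
          * (‖u τ‖ + (diagMass (u τ)).toReal) := by
  have hkcont := hk.continuous
  have hΔ := continuous_laplacian hk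
  have hΔc := hasCompactSupport_laplacian hkc
  have hΔe := laplacian_neg_of_even hk heven
  set β : L2 d := star (u t + u s) with hβ
  have hcβ : ContinuousOn (fun _ : ℝ => β) (Ico 0 T) := continuousOn_const
  have hP := fun r (hr : r ∈ Ico 0 T) => hu.intervalIntegrable_pair hΔc hΔ hcβ hr
  have hN := fun r (hr : r ∈ Ico 0 T) => hu.intervalIntegrable_npair hd hkc hkcont hcβ hr
  have hG := fun r (hr : r ∈ Ico 0 T) =>
    (hu.intervalIntegrable_npair hd hkc hkcont hu.continuousOn_star hr).im
  have hW := fun r (hr : r ∈ Ico 0 T) => hu.intervalIntegrable_weight hd hr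
  have hPst := (hP s hs).symm.trans (hP t ht)
  have hNst := (hN s hs).symm.trans (hN t ht)
  have hGst := (hG s hs).symm.trans (hG t ht)
  have hWst := (hW s hs).symm.trans (hW t ht)
  have e1 := hu.weak_eq_pair hd hkc hk ht β
  have e2 := hu.weak_eq_pair hd hkc hk hs β
  have e3 := intervalIntegral.integral_add_adjacent_intervals (hP s hs) hPst
  have e4 := intervalIntegral.integral_add_adjacent_intervals (hN s hs) hNst
  rw [← e3, ← e4] at e1
  set P := ∫ τ in s..t, pair (Laplacian.laplacian k) (u τ) β
  set Q := ∫ τ in s..t, npair k (u τ) β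
  -- Subtract the equations at t and s and multiply by -i; real parts then turn the integrals into
  -- imaginary parts.
  have e5 : pair k (u t) β - pair k (u s) β = Complex.I * P - Complex.I * (σ * Q) := by
    linear_combination (-Complex.I) * (e1 - e2)
      + (pair k (u t) β - pair k (u s) β) * Complex.I_mul_I
  have e6 := congrArg Complex.re e5
  rw [hβ, re_pair_sub_star_add hkc hkcont heven] at e6
  have e7 : (Complex.I * P - Complex.I * (σ * Q)).re = -P.im + σ * Q.im := by
    simp
  rw [e7, intervalIntegral_im hPst, intervalIntegral_im hNst] at e6
  have e8 : (pair k (u t) (star (u t))).re - (pair k (u s) (star (u s))).re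
        - 2 * σ * ∫ τ in s..t, (npair k (u τ) (star (u τ))).im
      = ∫ τ in s..t, (-(pair (Laplacian.laplacian k) (u τ) β).im
        + σ * ((npair k (u τ) β).im - 2 * (npair k (u τ) (star (u τ))).im)) := by
    have hneg : IntervalIntegrable
        (fun τ => -(pair (Laplacian.laplacian k) (u τ) β).im) volume s t := hPst.im.neg
    rw [intervalIntegral.integral_add hneg ((hNst.im.sub (hGst.const_mul 2)).const_mul σ),
      intervalIntegral.integral_neg, intervalIntegral.integral_const_mul,
      intervalIntegral.integral_sub hNst.im (hGst.const_mul 2),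
      intervalIntegral.integral_const_mul, e6]
    ring
  rw [e8, ← Real.norm_eq_abs, ← intervalIntegral.integral_const_mul]
  refine intervalIntegral.norm_integral_le_of_norm_le hst ?_ ((hWst.const_mul _).const_mul _)
  filter_upwards [hu.ae_diagMass_lt_top hd ht] with τ hτ hτ'
  have hτm : diagMass (u τ) < ⊤ := hτ (by
    rw [uIoc_of_le ht.1]; exact ⟨hs.1.trans_lt hτ'.1, hτ'.2⟩)
  have b1 := abs_im_pair_le hΔc hΔ hΔe (u t) (u s) (u τ)
  have b2 := abs_im_npair_sub_le hd hkc hkcont (u t) (u s) hτm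
  have b3 := hω τ (Ioc_subset_Icc_self hτ')
  have k1 := kernelBound_nonneg (Laplacian.laplacian k)
  have k2 := kernelBound_nonneg k
  set w := ‖u τ‖ + (diagMass (u τ)).toReal with hw
  have hw0 : 0 ≤ w := by positivity
  have hle : ‖u τ‖ ≤ w := le_add_of_nonneg_right ENNReal.toReal_nonneg
  rw [Real.norm_eq_abs]
  calc _ ≤ |(pair (Laplacian.laplacian k) (u τ) β).im|
        + |σ| * |(npair k (u τ) β).im - 2 * (npair k (u τ) (star (u τ))).im| := by
        refine (abs_add_le _ _).trans_eq ?_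
        rw [abs_neg, abs_mul]
    _ ≤ kernelBound (Laplacian.laplacian k) * w * r₀ + |σ| * (kernelBound k * w * r₀) := by
        gcongr
        · exact b1.trans (by gcongr)
        · exact b2.trans (by gcongr)
    _ = _ := by ring

theorem IsSolution.re_pair_eq (hd : 0 < d) (hu : IsSolution σ T u₀ u)
    (hkc : HasCompactSupport k) (hk : ContDiff ℝ ∞ k) (heven : ∀ x, k (-x) = k x)
    {t : ℝ} (ht : t ∈ Ico 0 T) :
    (pair k (u t) (star (u t))).re - (pair k u₀ (star u₀)).re
      = 2 * σ * ∫ τ in (0 : ℝ)..t, (npair k (u τ) (star (u τ))).im := by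
  have hG := fun r (hr : r ∈ Ico 0 T) =>
    (hu.intervalIntegrable_npair hd hkc hk.continuous hu.continuousOn_star hr).im
  set H : ℝ → ℝ := fun τ => (kernelBound (Laplacian.laplacian k) + |σ| * kernelBound k)
          * (‖u τ‖ + (diagMass (u τ)).toReal) with hH
  have hHi := fun r (hr : r ∈ Ico 0 T) => (hu.intervalIntegrable_weight hd hr).const_mul
    (kernelBound (Laplacian.laplacian k) + |σ| * kernelBound k)
  have key := eq_of_forall_small_increment (t₁ := t) ht.1
    (D := fun r => (pair k (u r) (star (u r))).re
      - 2 * σ * ∫ τ in (0 : ℝ)..r, (npair k (u τ) (star (u τ))).im)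
    (K := fun r => ∫ τ in (0 : ℝ)..r, H τ) ?_
  · simp only [intervalIntegral.integral_same, mul_zero, sub_zero, hu.initial] at key
    linarith
  · intro η hη
    have huc := isCompact_Icc.uniformContinuousOn_of_continuous
      (hu.continuousOn.mono (Icc_subset_Ico_right ht.2))
    obtain ⟨δ, hδ, hδ'⟩ := Metric.uniformContinuousOn_iff.1 huc (η / 2) (by positivity)
    refine ⟨δ, hδ, fun s r hs hsr hrt hrs => ?_⟩
    have hs' : s ∈ Ico 0 T := ⟨hs, (hsr.trans hrt).trans_lt ht.2⟩
    have hr' : r ∈ Ico 0 T := ⟨hs.trans hsr, hrt.trans_lt ht.2⟩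
    have h1 := hu.abs_increment_le hd hkc hk heven hs' hr' hsr (r₀ := η) fun τ hτ => by
      have hτt : τ ∈ Icc 0 t := ⟨hs.trans hτ.1, hτ.2.trans hrt⟩
      have a1 := hδ' r ⟨hr'.1, hrt⟩ τ hτt (by
        rw [Real.dist_eq, abs_of_nonneg (by linarith [hτ.2])]; linarith [hτ.1])
      have a2 := hδ' s ⟨hs, hsr.trans hrt⟩ τ hτt (by
        rw [Real.dist_eq, abs_sub_comm, abs_of_nonneg (by linarith [hτ.1])]; linarith [hτ.2])
      rw [dist_eq_norm] at a1 a2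
      linarith
    have e1 := intervalIntegral.integral_add_adjacent_intervals (hG s hs')
      ((hG s hs').symm.trans (hG r hr'))
    have e2 := intervalIntegral.integral_add_adjacent_intervals (hHi s hs')
      ((hHi s hs').symm.trans (hHi r hr'))
    simp only [hH]
    rw [← e1, ← e2, add_sub_cancel_left]
    refine le_trans (le_of_eq ?_) h1
    congr 1
    ring

theorem lintegral_npair_self_le (hd : 0 < d) (hk : Continuous k) (a : L2 d) :
    ∫⁻ x, ‖nonlinearity d (a x) * mollify k (star a : L2 d) x‖ₑ
      ≤ (∫⁻ y, ‖k y‖ₑ) * (diagMass a + diagMass (star a)) :=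
  lintegral_mul_mollify_le hk (aestronglyMeasurable_nonlinearity hd a)
    (Lp.aestronglyMeasurable _)
    fun y => lintegral_nonlinearity_mul_comp_le hd a _ (measurePreserving_sub_right_space y)

theorem diagMass_star (a : L2 d) : diagMass (star a) = diagMass a := by
  rw [diagMass, diagMass]
  congr 1
  refine eLpNorm_congr_norm_ae ?_
  filter_upwards [Lp.coeFn_star a] with x hx
  rw [hx, Pi.star_apply, norm_star]

/-- A bound uniform in n, from the unit mass of the mollifier; `kernelBound` also involves its L²
norm. It serves as the dominating function. -/
theorem norm_npair_mollifier_le (hd : 0 < d) {a : L2 d} (ha : diagMass a < ⊤) (n : ℕ) :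
    ‖npair (mollifier d n) a (star a)‖ ≤ 2 * (diagMass a).toReal := by
  have h := (enorm_integral_le_lintegral_enorm _).trans
    (lintegral_npair_self_le hd (continuous_mollifier d n) a)
  rw [lintegral_mollifier, one_mul, diagMass_star, ← two_mul] at h
  have h2 := ENNReal.toReal_mono (ENNReal.mul_lt_top (by simp) ha).ne h
  rw [toReal_enorm, ENNReal.toReal_mul] at h2
  exact h2

/-- N(a) lies in L^{p'} and the conjugate of a in L^p, so their correlation is continuous; at 0 it
is the integral of |a|^p, which is real. -/
theorem tendsto_npair_mollifier_im (hd : 0 < d) {a : L2 d} (ha : diagMass a < ⊤) :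
    Tendsto (fun n => (npair (mollifier d n) a (star a)).im) atTop (𝓝 0) := by
  have hp := two_le_diagExp hd
  have hconj : (diagExp d / (diagExp d - 1)).HolderConjugate (diagExp d) :=
    (Real.HolderConjugate.conjExponent (by linarith : 1 < diagExp d)).symm
  have : (ENNReal.ofReal (diagExp d / (diagExp d - 1))).HolderConjugate
    (ENNReal.ofReal (diagExp d)) := hconj.ennrealOfReal
  have : Fact (1 ≤ ENNReal.ofReal (diagExp d / (diagExp d - 1))) := ⟨by
    simpa using hconj.lt.le⟩
  have : Fact (1 ≤ ENNReal.ofReal (diagExp d)) := ⟨by simpa using by linarith⟩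
  have ha' : diagMass (star a) < ⊤ := by rwa [diagMass_star]
  have hc := continuous_corr (p := ENNReal.ofReal (diagExp d / (diagExp d - 1)))
    ENNReal.ofReal_ne_top (memLp_nonlinearity hd ha) (memLp_of_diagMass_lt_top hd ha')
  have h := tendsto_integral_mollifier_mul hc
  have h1 : (corr (fun x => nonlinearity d (a x)) (star a : L2 d) 0).im = 0 := by
    have h2 : corr (fun x => nonlinearity d (a x)) (star a : L2 d) 0
        = ∫ x, ((‖a x‖ ^ (4 / (d : ℝ)) * ‖a x‖ ^ 2 : ℝ) : ℂ) := by
      rw [corr]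
      refine integral_congr_ae ?_
      filter_upwards [Lp.coeFn_star a] with x hx
      rw [sub_zero, hx, ← nonlinearity_mul_conj]
      rfl
    rw [h2, integral_complex_ofReal, Complex.ofReal_im]
  have h3 := (Complex.continuous_im.tendsto _).comp h
  rw [h1] at h3
  refine h3.congr fun n => ?_
  rw [Function.comp_apply, npair_eq_integral_corr hd (hasCompactSupport_mollifier d n)
    (continuous_mollifier d n) ha ha']

theorem tendsto_pair_mollifier_re (a : L2 d) :
    Tendsto (fun n => (pair (mollifier d n) a (star a)).re) atTop (𝓝 (‖a‖ ^ 2)) := by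
  have hc := continuous_corr (p := 2) (q := 2) (by norm_num) (Lp.memLp a) (Lp.memLp (star a))
  have h := (Complex.continuous_re.tendsto _).comp (tendsto_integral_mollifier_mul hc)
  have h1 : (corr a (star a : L2 d) 0).re = ‖a‖ ^ 2 := by
    have h2 : corr a (star a : L2 d) 0 = inner ℂ a a := by
      rw [corr, L2.inner_def]
      refine integral_congr_ae ?_
      filter_upwards [Lp.coeFn_star a] with x hx
      rw [sub_zero, hx, RCLike.inner_apply]
      rfl
    rw [h2, inner_self_eq_norm_sq_to_K]
    norm_cast
  rw [h1] at h
  refine h.congr fun n => ?_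
  rw [Function.comp_apply, pair_eq_integral_corr (hasCompactSupport_mollifier d n)
    (continuous_mollifier d n)]

/-- Pass to the limit in `IsSolution.re_pair_eq` along the mollifiers: the left side tends to the
difference of masses, the right side to 0 by dominated convergence. -/
theorem IsSolution.norm_eq (hd : 0 < d) (hu : IsSolution σ T u₀ u) {t : ℝ} (ht : t ∈ Ico 0 T) :
    ‖u t‖ = ‖u₀‖ := by
  have h1 := (tendsto_pair_mollifier_re (u t)).sub (tendsto_pair_mollifier_re u₀)
  have h2 : Tendsto (fun n => 2 * σ *
      ∫ τ in (0 : ℝ)..t, (npair (mollifier d n) (u τ) (star (u τ))).im) atTop (𝓝 0) := by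
    have h3 : Tendsto (fun n => ∫ τ in (0 : ℝ)..t,
        (npair (mollifier d n) (u τ) (star (u τ))).im) atTop
        (𝓝 (∫ _ in (0 : ℝ)..t, (0 : ℝ))) := by
      refine intervalIntegral.tendsto_integral_filter_of_dominated_convergence
        (fun τ => 2 * (diagMass (u τ)).toReal) (Eventually.of_forall fun n => ?_)
        (Eventually.of_forall fun n => ?_)
        ((hu.intervalIntegrable_diagDensity hd ht).const_mul 2) ?_
      · exact Complex.continuous_im.comp_aestronglyMeasurable
          (hu.aestronglyMeasurable_npair hd (continuous_mollifier d n) hu.continuousOn_star ht)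
      · filter_upwards [hu.ae_diagMass_lt_top hd ht] with τ hτ hτ'
        rw [Real.norm_eq_abs]
        exact (Complex.abs_im_le_norm _).trans (norm_npair_mollifier_le hd (hτ hτ') n)
      · filter_upwards [hu.ae_diagMass_lt_top hd ht] with τ hτ hτ'
        exact tendsto_npair_mollifier_im hd (hτ hτ')
    simpa using h3.const_mul (2 * σ)
  have h4 : ‖u t‖ ^ 2 - ‖u₀‖ ^ 2 = 0 := by
    refine tendsto_nhds_unique (h1.congr fun n => ?_) h2
    exact hu.re_pair_eq hd (hasCompactSupport_mollifier d n) (contDiff_mollifier d n)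
      (mollifier_neg d n) ht
  exact (sq_eq_sq₀ (norm_nonneg _) (norm_nonneg _)).1 (sub_eq_zero.1 h4)

end MassConservation

/-! ### Conclusion: conservation of mass supplies the L² bound for the local estimate. -/

theorem mainTheorem3 (d : ℕ) (hd : 0 < d) (ε A : ℝ) (hε : 0 < ε) (hA : 0 < A) :
    ∃ c : ℝ, 0 < c ∧
      ∀ (σ T α : ℝ) (u₀ : L2 d) (u : ℝ → L2 d),
        (σ = 1 ∨ σ = -1) → 0 < T → 1 / 2 ≤ α →
        IsMaximalSolution σ T u₀ u →
        ENNReal.ofReal ε ≤ limsup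
          (fun t : ℝ => supCubeMass (freqTrunc (A * kappa u₀ ε / (T - t) ^ α) (u t))
            ((T - t) ^ α)) (𝓝[<] T) →
        ∃ t : ℕ → ℝ, StrictMono t ∧ (∀ n, t n ∈ Ioo 0 T) ∧ Tendsto t atTop (𝓝 T) ∧
          ∀ n, DifferentiableAt ℝ (strichartzF u) (t n) ∧
            c / (T - t n) ^ (2 * α) ≤ deriv (strichartzF u) (t n) := by
  obtain ⟨c, hc, h⟩ := exists_const_deriv_strichartzF_ge hd hε hA
  exact ⟨c, hc, fun σ T α u₀ u _ hT _ hu hlim => h σ T α u₀ u hT hu.toIsSolution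
    (fun t ht => (hu.toIsSolution.norm_eq hd ht).le) hlim⟩
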